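/- Let $\alpha\ge 3$ be a countable ordinal which is the successor of a successor ordinal. Then the directed graph $H_\alpha$ on $\mathbb{Y}_\alpha$, defined below, has no countable $\boldsymbol\Sigma^0_\alpha$ colouring: there is no map $c\colon \mathbb{Y}_\alpha\to\mathbb N$ such that every $c^{-1}\{n\}$ is a $\boldsymbol\Sigma^0_\alpha$ subset of $\mathbb{Y}_\alpha$ (with the subspace topology) and $c(p)\neq c(q)$ for every edge $(p,q)$ of $H_\alpha$. This holds for every choice of the auxiliary data (1)–(3). **Auxiliary data.** (1) An identification of $\alpha$ with a well-ordering of a subset of $\mathbb N$, where $a_\beta\in\mathbb N$ denotes the element at position $\beta<\alpha$; and for every limit $\delta\le\alpha$ an increasing cofinal sequence $(\delta_k)_{k\in\mathbb N}$ in $\delta$. These determine the tree $T_\alpha\subset\mathbb N^{<\omega}$ and its rank function: the root has rank $\alpha$; if $\sigma\in T_\alpha$ has rank $\beta+1$ then every $\sigma\hat{\ }k$ is in $T_\alpha$ and has rank $\beta$; if $\sigma$ has limit rank $\delta$ then every $\sigma\hat{\ }k$ is in $T_\alpha$ and has rank $\delta_k$; the set $\mathscr L_\alpha$ of leaves consists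 of the nodes of rank $0$. (2) For every $\beta<\alpha$, an ordering $<^*_\beta$ of type $\omega$ of the nodes of rank $\beta$, such that $\sigma\hat{\ }k<^*_\beta\sigma\hat{\ }k'$ whenever $k<k'$ and both have rank $\beta$. (3) A sequence $(M_k)_{k\in\mathbb N}$ which is dense in $2^{\mathbb N}$. A number $k$ is a *code* of a finite binary string $\zeta$ if $\zeta\prec M_k$. **Labellings.** For $x\in 2^{\mathscr L_\alpha}$ define $T^x\colon T_\alpha\to\{0,1\}$ by $T^x(\sigma)=x(\sigma)$ for leaves, and, for non-leaves, $T^x(\sigma)=0$ iff $T^x(\sigma\hat{\ }k)=1$ for some $k$. Write $T^x(m,k)$ for $T^x(\langle m,k\rangle)$, etc. Let $n^x=\sup\{n: T^x(m)=0 \text{ for all } m<n\}\le\omega$, and for $m<n^x$ let $k^x(m)$ be the least $k$ with $T^x(m,k)=1$. **True stages.** Let $2^{<\mathscr L_\alpha}$ be the set of $\{0,1\}$-valued functions $t$ on finite $<^*_0$-initial segments of $\mathscr L_\alpha$, and $|t|$ the size of the domain; $s\prec t$ denotes proper extension. Partial labellings $T^t$ of $T_\alpha$ are defined by recursion on $|t|$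 and, for each $t$, on the rank of nodes; a subscript $\beta$ denotes restriction to nodes of rank $<\beta$. $T^{\langle\rangle}$ is empty. For nonempty $t$, $T^t(\sigma)=t(\sigma)$ on leaves. Let $0<\beta<\alpha$. If there are at most $a_\beta$ many $s\prec t$ with $T^s_\beta\subseteq T^t_\beta$, then $T^t$ is undefined on all nodes of rank $\beta$. Otherwise let $s$ be the longest such $s$, and let $\tau$ be the $<^*_\beta$-least node of rank $\beta$ such that either $T^s(\tau)$ is undefined, or $T^s(\tau)=1$ and $T^t(\tau\hat{\ }k)=1$ for some $k$. For $\sigma$ of rank $\beta$: if $\sigma<^*_\beta\tau$ then $T^t(\sigma)=T^s(\sigma)$; if $\sigma>^*_\beta\tau$ then $T^t(\sigma)$ is undefined; and $T^t(\tau)=0$ if $T^t(\tau\hat{\ }k)=1$ for some $k$, and $T^t(\tau)=1$ otherwise. (The label of the root is never used below.) **Coding locations.** Let $\alpha^*=\alpha-2$. For $s,t$ finite or infinite (i.e. in $2^{<\mathscr L_\alpha}\cup 2^{\mathscr L_\alpha}$) write $s\preceq_{\alpha^*}t$ if $T^s_{\alpha^*}\subseteq T^t_{\alpha^*}$, and $s\prec_{\alpha^*}t$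 if also $s\ne t$. For finite $t$ define $n^t$ by recursion: $n^{\langle\rangle}=0$; if $t\ne\langle\rangle$, let $s$ be the longest with $s\prec_{\alpha^*}t$; if there are $m<n^s$ and $a$ with $T^t(m,k^s(m),a)=1$ then $n^t$ is the least such $m$, and otherwise $n^t=n^s+1$. For $m<n^t$, $k^t(m)$ is the least $k$ such that there is no $a$ with $T^t(m,k,a)=1$. Write $s\sqsubseteq_m x$ if $s\preceq_{\alpha^*}x$, $m\le\min\{n^s,n^x\}$, and $k^s(\ell)=k^x(\ell)$ for all $\ell<m$. For $x\in 2^{\mathscr L_\alpha}$ and finite $m\le n^x$ let $c^x(m)=\min\{|s|: s\in 2^{<\mathscr L_\alpha},\ s\sqsubseteq_m x\}$. **The graph.** $\mathbb{Y}_\alpha$ is the set of all $(x,y)\in 2^{\mathscr L_\alpha}\times\mathscr P(\mathbb N)$ (with the product, i.e. Cantor, topology) such that for all $m<n^x$, $k^x(m)$ is a code of $y\restriction(c^x(m)+1)$, where $y$ is identified with its characteristic function. For $(x,y),(x',y')\in\mathbb{Y}_\alpha$, $((x,y),(x',y'))$ is an edge of $H_\alpha$ iff $x=x'$, $n^x<\omega$,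 $y\bigtriangleup y'=\{c^x(n^x)\}$ and $c^x(n^x)\notin y$. -/

import Mathlib

namespace BorelColouring

/-! ### The Borel hierarchy and countable colourings -/

/-- `IsSigma β A`: the set `A` is boldface `Σ⁰_β` (for a metrizable space `X`): the `Σ⁰_1` sets are
the open sets, and for `β > 1` the `Σ⁰_β` sets are the countable unions of sets which are `Π⁰_γ`
(that is, with `Σ⁰_γ` complement) for some `1 ≤ γ < β`. -/
inductive IsSigma {X : Type} [TopologicalSpace X] : Ordinal.{0} → Set X → Prop
  | of_isOpen (A : Set X) (hA : IsOpen A) : IsSigma 1 A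
  | iUnion (β : Ordinal.{0}) (hβ : 1 < β) (A : ℕ → Set X) (γ : ℕ → Ordinal.{0})
      (h1 : ∀ n, 1 ≤ γ n) (hlt : ∀ n, γ n < β) (hA : ∀ n, IsSigma (γ n) (A n)ᶜ) :
      IsSigma β (⋃ n, A n)

/-- The directed graph `G` on `X` has a countable `Σ⁰_β` colouring: a map `c : X → ℕ` whose colour
classes are all `Σ⁰_β`, such that the endpoints of every edge get different colours. -/
def HasCountableSigmaColouring {X : Type} [TopologicalSpace X] (β : Ordinal.{0})
    (G : Digraph X) : Prop :=
  ∃ c : X → ℕ, (∀ n, IsSigma β (c ⁻¹' {n})) ∧ ∀ p q, G.Adj p q → c p ≠ c q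

/-! ### The tree `T_α` -/

/-- The choices used to define the tree `T_α`: a copy of the well-ordering `α` with a subset of `ℕ`
as underlying set (`code β` is the element of this set at position `β < α`; this is the number
`a_β`, and `code β` is irrelevant for `β ≥ α`), and an increasing cofinal sequence `(δ_k)` in every limit `δ ≤ α`. Both
`δ_k = down δ k` for limits and `(β + 1)_k = β` are recorded in `down`. -/
structure Ladder (α : Ordinal.{0}) where
  code : Ordinal.{0} → ℕ
  code_injOn : Set.InjOn code (Set.Iio α)
  down : Ordinal.{0} → ℕ → Ordinal.{0}
  down_succ : ∀ β < α, ∀ k, down (β + 1) k = β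
  down_strictMono : ∀ δ ≤ α, Order.IsSuccLimit δ → StrictMono (down δ)
  down_limit_lt : ∀ δ ≤ α, Order.IsSuccLimit δ → ∀ k, down δ k < δ
  down_cofinal : ∀ δ ≤ α, Order.IsSuccLimit δ → ∀ β < δ, ∃ k, β ≤ down δ k

namespace Ladder

variable {α : Ordinal.{0}} (L : Ladder α)

/-- The rank of `τ` in the tree whose root has rank `β`. -/
def rankFrom (β : Ordinal.{0}) : List ℕ → Ordinal.{0}
  | [] => β
  | k :: τ => rankFrom (L.down β k) τ

/-- Membership of `τ` in the tree whose root has rank `β`; nodes of rank `0` are leaves. -/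
def InTreeFrom (β : Ordinal.{0}) : List ℕ → Prop
  | [] => True
  | k :: τ => β ≠ 0 ∧ InTreeFrom (L.down β k) τ

/-- The rank of a node of `T_α` (meaningful only for `σ` in `T_α`). -/
def rank (σ : List ℕ) : Ordinal.{0} := L.rankFrom α σ

/-- `σ ∈ T_α`. The child of `σ` with index `k` is `σ ++ [k]`. -/
def InTree (σ : List ℕ) : Prop := L.InTreeFrom α σ

/-- The leaves of `T_α`: the nodes of rank `0`. -/
abbrev Leaf : Type := {σ : List ℕ // L.InTree σ ∧ L.rank σ = 0}

/-- The nodes of `T_α` of rank `β`. -/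
def level (β : Ordinal.{0}) : Set (List ℕ) := {σ | L.InTree σ ∧ L.rank σ = β}

theorem down_lt {β : Ordinal.{0}} (hβ : β ≤ α) (h0 : β ≠ 0) (k : ℕ) : L.down β k < β := by
  rcases Ordinal.zero_or_succ_or_isSuccLimit β with h | ⟨γ, rfl⟩ | h
  · exact absurd h h0
  · have hγ : γ < α := lt_of_lt_of_le (Order.lt_succ γ) hβ
    have := L.down_succ γ hγ k
    rw [← Order.succ_eq_add_one] at this
    rw [this]
    exact Order.lt_succ γ
  · exact L.down_limit_lt β hβ h k

theorem rankFrom_append_lt (k : ℕ) : ∀ (σ : List ℕ) (β : Ordinal.{0}), β ≤ α →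
    L.InTreeFrom β σ → L.rankFrom β σ ≠ 0 → L.rankFrom β (σ ++ [k]) < L.rankFrom β σ
  | [], _, hβ, _, h0 => L.down_lt hβ h0 k
  | j :: σ, _, hβ, hσ, h0 =>
    rankFrom_append_lt k σ _ ((L.down_lt hβ hσ.1 j).le.trans hβ) hσ.2 h0

theorem rank_append_lt {σ : List ℕ} (hσ : L.InTree σ) (h0 : L.rank σ ≠ 0) (k : ℕ) :
    L.rank (σ ++ [k]) < L.rank σ :=
  L.rankFrom_append_lt k σ α le_rfl hσ h0

end Ladder

/-- A presentation of `α`: in addition to the choices for `T_α`, for every `β < α` an `ω`-ordering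
`<*_β` of the nodes of rank `β`, given by the position `pos σ ∈ ℕ` of each node in the ordering
(so `σ <*_β τ` iff `pos σ < pos τ`), such that siblings of the same rank are ordered by their
last entries. -/
structure Presentation (α : Ordinal.{0}) extends Ladder α where
  pos : List ℕ → ℕ
  pos_bijOn : ∀ β < α, Set.BijOn pos (toLadder.level β) Set.univ
  pos_sibling : ∀ β < α, ∀ (σ : List ℕ) (k k' : ℕ), k < k' →
    σ ++ [k] ∈ toLadder.level β → σ ++ [k'] ∈ toLadder.level β →
    pos (σ ++ [k]) < pos (σ ++ [k'])

/-- A partial `{0,1}`-labelling of `T_α`: `none` means undefined, `some true` is the label `1`,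
`some false` is the label `0`. Labellings are always undefined outside `T_α`. -/
abbrev Labelling : Type := List ℕ → Option Bool

namespace Presentation

open Classical

variable {α : Ordinal.{0}} (P : Presentation α)

/-- The point space `𝕏_α = 2^{leaves} × 𝒫(ℕ)`, a subset of `ℕ` being identified with its
characteristic function; both factors carry the product topology. -/
abbrev Point : Type := (P.Leaf → Bool) × (ℕ → Bool)

/-- The labelling `T^x` of `T_α` determined by a labelling `x` of the leaves: a non-leaf is labelled
`0` iff some child is labelled `1`. -/
noncomputable def fullLabel (x : P.Leaf → Bool) (σ : List ℕ) : Option Bool :=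
  if hσ : P.InTree σ then
    if h0 : P.rank σ = 0 then some (x ⟨σ, hσ, h0⟩)
    else if ∃ k, fullLabel x (σ ++ [k]) = some true then some false else some true
  else none
termination_by P.rank σ
decreasing_by exact P.rank_append_lt hσ h0 k

/-- `f_β ⊆ g_β`, where the subscript denotes the restriction to the nodes of rank `< β`. -/
def SubBelow (β : Ordinal.{0}) (f g : Labelling) : Prop :=
  ∀ σ, P.InTree σ → P.rank σ < β → ∀ b, f σ = some b → g σ = some b

/-! ### True stages

A finite initial segment of an element of `2^{leaves}` is a finite list `t` of bits, whose `i`-th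
entry is the label of the leaf with position `i` in `<*_0`. Its initial segments are the
`t.take i`. -/

/-- Given labellings `prev i` for `i < l` and a labelling `cur`, the set of `i < l` such that
`(prev i)_β ⊆ cur_β`. -/
noncomputable def preds (β : Ordinal.{0}) (l : ℕ) (prev : ℕ → Labelling) (cur : Labelling) :
    Finset ℕ :=
  (Finset.range l).filter fun i => P.SubBelow β (prev i) cur

/-- The node `τ` requires attention, when `s` is the labelling of the last relevant stage and `cur`
is the current labelling. -/
def Attention (s cur : Labelling) (τ : List ℕ) : Prop :=
  s τ = none ∨ (s τ = some true ∧ ∃ k, cur (τ ++ [k]) = some true)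

/-- The value of `T^t` at `σ`, given the labellings `prev i` of the initial segments of length
`i < |t|`, and the labelling `cur = T^t` on nodes of rank smaller than `rank σ`. In the last case,
`σ` lies before the `<*_β`-least node requiring attention. -/
noncomputable def labelStep (t : List Bool) (prev : ℕ → Labelling) (cur : Labelling)
    (σ : List ℕ) : Option Bool :=
  if ¬ P.InTree σ then none
  else if P.rank σ = 0 then t[P.pos σ]?
  else
    let S := P.preds (P.rank σ) t.length prev cur
    if S.card ≤ P.code (P.rank σ) then none
    else
      let s := prev (S.sup id)
      if ∃ τ ∈ P.level (P.rank σ), P.pos τ < P.pos σ ∧ Attention s cur τ then none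
      else if Attention s cur σ then
        if ∃ k, cur (σ ++ [k]) = some true then some false else some true
      else s σ

/-- The labelling of the string `t` by recursion on the rank of nodes, given the labellings of the
proper initial segments of `t`. -/
noncomputable def labelFrom (t : List Bool) (prev : ℕ → Labelling) (σ : List ℕ) : Option Bool :=
  P.labelStep t prev (fun ρ => if P.rank ρ < P.rank σ then labelFrom t prev ρ else none) σ
termination_by P.rank σ

/-- The partial labelling `T^t` of `T_α` for a finite string `t`. -/
noncomputable def approx (t : List Bool) : Labelling :=
  P.labelFrom t fun i => if i < t.length then approx (t.take i) else fun _ => none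
termination_by t.length
decreasing_by simp only [List.length_take]; omega

/-- `α* = α - 2` (for `α` a successor of a successor). -/
noncomputable def star (_P : Presentation α) : Ordinal.{0} := Ordinal.pred (Ordinal.pred α)

/-- The length of the longest `s ≺ t` (proper) such that `s ≺_{α*} t`; for nonempty `t`. -/
noncomputable def predLength (t : List Bool) : ℕ :=
  (P.preds P.star t.length (fun i => P.approx (t.take i)) (P.approx t)).sup id

theorem predLength_lt {t : List Bool} (ht : t ≠ []) : P.predLength t < t.length := by
  have h0 : 0 < t.length := List.length_pos_iff.2 ht
  refine (Finset.sup_lt_iff (by simpa using h0)).2 fun i hi => ?_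
  exact Finset.mem_range.1 (Finset.mem_filter.1 hi).1

/-! ### The numbers `n` and `k` -/

/-- `n^x = sup {n : T^x(m) = 0 for all m < n}`, possibly infinite. -/
noncomputable def nPoint (x : P.Leaf → Bool) : ℕ∞ :=
  ⨆ n ∈ {n : ℕ | ∀ m < n, P.fullLabel x [m] = some false}, (n : ℕ∞)

/-- `k^x(m)`, for `m < n^x`: the least `k` such that `T^x(m,k) = 1`. -/
noncomputable def kPoint (x : P.Leaf → Bool) (m : ℕ) : ℕ :=
  sInf {k | P.fullLabel x [m, k] = some true}

/-- `k^t(m)`, for `m < n^t`: the least `k` such that there is no `a` with `T^t(m,k,a) = 1`. -/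
noncomputable def kString (t : List Bool) (m : ℕ) : ℕ :=
  sInf {k | ¬ ∃ a, P.approx t [m, k, a] = some true}

/-- `n^t`: it is `0` for the empty string; otherwise, let `s` be longest with `s ≺_{α*} t`; then
`n^t` is the least `m < n^s` such that `T^t(m, k^s(m), a) = 1` for some `a`, if there is one, and
`n^s + 1` otherwise. -/
noncomputable def nString (t : List Bool) : ℕ :=
  if _ht : t = [] then 0
  else
    let s := t.take (P.predLength t)
    if ∃ m < nString s, ∃ a, P.approx t [m, P.kString s m, a] = some true then
      sInf {m | m < nString s ∧ ∃ a, P.approx t [m, P.kString s m, a] = some true}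
    else nString s + 1
termination_by t.length
decreasing_by
  all_goals
    have := P.predLength_lt _ht
    simp only [List.length_take]
    omega

/-! ### Coding locations and the graph `H_α` -/

/-- `s ⊑_m x` for a finite string `s` and an infinite `x`: `s ≺_{α*} x`, `m ≤ n^s`, `m ≤ n^x`, and
`k^s(ℓ) = k^x(ℓ)` for all `ℓ < m`. -/
def SqExt (m : ℕ) (s : List Bool) (x : P.Leaf → Bool) : Prop :=
  P.SubBelow P.star (P.approx s) (P.fullLabel x) ∧ m ≤ P.nString s ∧ (m : ℕ∞) ≤ P.nPoint x ∧
    ∀ ℓ < m, P.kString s ℓ = P.kPoint x ℓ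

/-- The coding location `c^x(m)`, for finite `m ≤ n^x`: the least length of a string `s` with
`s ⊑_m x`. -/
noncomputable def codeLoc (x : P.Leaf → Bool) (m : ℕ) : ℕ :=
  sInf {l | ∃ s : List Bool, s.length = l ∧ P.SqExt m s x}

/-- The set `𝕐_α` of the points `(x,y)` such that for all `m < n^x`, the number `k^x(m)` is a code for
`y ↾ (c^x(m) + 1)`, meaning that this string is an initial segment of `M_{k^x(m)}`. -/
def Y (M : ℕ → ℕ → Bool) : Set P.Point :=
  {p | ∀ m : ℕ, (m : ℕ∞) < P.nPoint p.1 →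
    ∀ j < P.codeLoc p.1 m + 1, p.2 j = M (P.kPoint p.1 m) j}

/-- The directed graph `H_α` on `𝕐_α`: `(x,y)` is related to `(x',y')` if `x = x'`, `n^x < ω`,
`y △ y' = {c^x(n^x)}` and `c^x(n^x) ∉ y`. -/
def H (M : ℕ → ℕ → Bool) : Digraph (P.Y M) where
  Adj p q := p.1.1 = q.1.1 ∧ ∃ n : ℕ, P.nPoint p.1.1 = (n : ℕ∞) ∧
    symmDiff {j | p.1.2 j = true} {j | q.1.2 j = true} = {P.codeLoc p.1.1 n} ∧
    P.codeLoc p.1.1 n ∉ {j | p.1.2 j = true}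

end Presentation

end BorelColouring

/-!
Once `n^x` and `k^x` are fixed, the coding locations `c^x(m)` depend continuously on the labels of
rank below `α*`, because the finite approximations to `T^x` converge to it along the true stages.
Suppose that a countable colouring by `Σ⁰_{α*+2}` sets exists, and write the colour classes as
countable unions of `Π⁰_{α*+1}` sets, none of which contains both ends of an edge. Build a vertex
`(x, y)` generically, from finite conditions that fix labels of `x` up to rank `α*` and bits of `y`.
Membership in a `Π⁰_{α*+1}` set is an intersection of `Σ⁰_{α*}` events, and each of these is forced
by adding labels of rank below `α*` only, which leaves `n^x` and `k^x` alone. So if some condition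
could not be extended to one forcing `(x, y)` out of a given set, then, after reaching a coding
location `c^x(n^x)` beyond the bits fixed so far, the set would contain `(x, y)` for both values of
the bit `y(c^x(n^x))`, that is, both ends of an edge. Hence a sufficiently generic vertex lies in
none of the sets.
-/

namespace BorelColouring

open Filter

/-! ### The tree -/

namespace Ladder

variable {α : Ordinal.{0}} (L : Ladder α)

theorem rankFrom_append (k : ℕ) : ∀ (σ : List ℕ) (β : Ordinal.{0}),
    L.rankFrom β (σ ++ [k]) = L.down (L.rankFrom β σ) k
  | [], _ => rfl
  | _ :: σ, _ => rankFrom_append k σ _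

theorem inTreeFrom_append (k : ℕ) : ∀ (σ : List ℕ) (β : Ordinal.{0}),
    L.InTreeFrom β (σ ++ [k]) ↔ L.InTreeFrom β σ ∧ L.rankFrom β σ ≠ 0
  | [], β => by simp [InTreeFrom, rankFrom]
  | j :: σ, β => by
    simp only [List.cons_append, InTreeFrom, rankFrom, inTreeFrom_append k σ (L.down β j),
      and_assoc]

theorem rank_append (σ : List ℕ) (k : ℕ) : L.rank (σ ++ [k]) = L.down (L.rank σ) k :=
  L.rankFrom_append k σ α

theorem inTree_append {σ : List ℕ} {k : ℕ} :
    L.InTree (σ ++ [k]) ↔ L.InTree σ ∧ L.rank σ ≠ 0 :=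
  L.inTreeFrom_append k σ α

theorem rankFrom_le : ∀ (σ : List ℕ) (β : Ordinal.{0}), β ≤ α → L.InTreeFrom β σ →
    L.rankFrom β σ ≤ β
  | [], _, _, _ => le_rfl
  | j :: σ, _, hβ, h =>
    (rankFrom_le σ _ ((L.down_lt hβ h.1 j).le.trans hβ) h.2).trans (L.down_lt hβ h.1 j).le

theorem rank_le {σ : List ℕ} (h : L.InTree σ) : L.rank σ ≤ α :=
  L.rankFrom_le σ α le_rfl h

variable {L} in
theorem inTree_append_of_mem_level {γ : Ordinal.{0}} (hγ : γ ≠ 0) {σ : List ℕ}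
    (hσ : σ ∈ L.level γ) (k : ℕ) : L.InTree (σ ++ [k]) :=
  L.inTree_append.2 ⟨hσ.1, hσ.2.trans_ne hγ⟩

variable {L} in
theorem rank_append_lt_of_mem_level {γ : Ordinal.{0}} (hγ : γ ≠ 0) {σ : List ℕ}
    (hσ : σ ∈ L.level γ) (k : ℕ) : L.rank (σ ++ [k]) < γ :=
  (L.rank_append_lt hσ.1 (hσ.2.trans_ne hγ) k).trans_eq hσ.2

theorem finite_rank_append_lt {σ : List ℕ} (hσ : L.InTree σ) {γ : Ordinal.{0}}
    (hγ : γ < L.rank σ) : {k | L.rank (σ ++ [k]) < γ}.Finite := by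
  simp only [rank_append]
  have hα := L.rank_le hσ
  rcases Ordinal.zero_or_succ_or_isSuccLimit (L.rank σ) with h | ⟨δ, h⟩ | h
  · simp [h] at hγ
  · rw [Order.succ_eq_add_one] at h
    rw [← h] at hα hγ ⊢
    convert Set.finite_empty
    ext k
    simpa [L.down_succ δ (Order.add_one_le_iff.1 hα)] using Order.lt_add_one_iff.1 hγ
  · obtain ⟨k₀, hk₀⟩ := L.down_cofinal _ hα h γ hγ
    refine (Set.finite_Iio k₀).subset fun k hk => ?_
    exact (L.down_strictMono _ hα h).lt_iff_lt.1 (lt_of_lt_of_le hk hk₀)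

theorem finite_code_lt (n : ℕ) : {γ | γ < α ∧ L.code γ < n}.Finite :=
  Set.Finite.of_finite_image
    ((Set.finite_Iio n).subset (Set.image_subset_iff.2 fun _ hγ => hγ.2))
    (L.code_injOn.mono fun _ hγ => hγ.1)

theorem exists_forall_le_code {δ : Ordinal.{0}} (hδ : Order.IsSuccLimit δ) (hδα : δ ≤ α) (n : ℕ) :
    ∃ β < δ, β ≠ 0 ∧ ∀ γ, β ≤ γ → γ < δ → n ≤ L.code γ := by
  classical
  set S := {γ ∈ (L.finite_code_lt n).toFinset | γ < δ} with hS
  refine ⟨S.sup Order.succ + 1, hδ.succ_lt ?_, Order.succ_ne_bot _, fun γ hβγ hγδ => ?_⟩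
  · exact (Finset.sup_lt_iff hδ.bot_lt).2 fun γ hγ => hδ.succ_lt (Finset.mem_filter.1 hγ).2
  · by_contra! hlt
    have hγ : γ ∈ S := by simp [hS, hγδ, hγδ.trans_le hδα, hlt]
    exact (Order.lt_succ γ).not_ge
      ((Finset.le_sup (f := Order.succ) hγ).trans ((Order.le_succ _).trans hβγ))

end Ladder

namespace Presentation

variable {α : Ordinal.{0}} (P : Presentation α)

theorem pos_injOn {γ : Ordinal.{0}} (hγ : γ < α) : Set.InjOn P.pos (P.level γ) :=
  (P.pos_bijOn γ hγ).injOn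

theorem exists_pos_eq {γ : Ordinal.{0}} (hγ : γ < α) (n : ℕ) : ∃ σ ∈ P.level γ, P.pos σ = n :=
  (P.pos_bijOn γ hγ).surjOn (Set.mem_univ n)

theorem infinite_level {γ : Ordinal.{0}} (hγ : γ < α) : (P.level γ).Infinite := by
  intro hfin
  have := hfin.image P.pos
  rw [(P.pos_bijOn γ hγ).image_eq] at this
  exact Set.infinite_univ this

theorem finite_pos_lt {γ : Ordinal.{0}} (hγ : γ < α) (n : ℕ) :
    {σ ∈ P.level γ | P.pos σ < n}.Finite :=
  Set.Finite.of_finite_image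
    ((Set.finite_Iio n).subset (Set.image_subset_iff.2 fun _ hσ => hσ.2))
    ((P.pos_injOn hγ).mono fun _ hσ => hσ.1)

theorem fullLabel_leaf (x : P.Leaf → Bool) (l : P.Leaf) : P.fullLabel x l = some (x l) := by
  rw [fullLabel]; simp [l.2.1, l.2.2]

open Classical in
theorem fullLabel_node (x : P.Leaf → Bool) {γ : Ordinal.{0}} (hγ : γ ≠ 0) {σ : List ℕ}
    (hσ : σ ∈ P.level γ) : P.fullLabel x σ =
      if ∃ k, P.fullLabel x (σ ++ [k]) = some true then some false else some true := by
  rw [fullLabel]; simp [hσ.1, hσ.2.trans_ne hγ]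

theorem fullLabel_eq_true_iff (x : P.Leaf → Bool) {γ : Ordinal.{0}} (hγ : γ ≠ 0) {σ : List ℕ}
    (hσ : σ ∈ P.level γ) :
    P.fullLabel x σ = some true ↔ ¬ ∃ k, P.fullLabel x (σ ++ [k]) = some true := by
  rw [P.fullLabel_node x hγ hσ]; split_ifs with h <;> simp [h]

theorem fullLabel_eq_false_iff (x : P.Leaf → Bool) {γ : Ordinal.{0}} (hγ : γ ≠ 0) {σ : List ℕ}
    (hσ : σ ∈ P.level γ) :
    P.fullLabel x σ = some false ↔ ∃ k, P.fullLabel x (σ ++ [k]) = some true := by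
  rw [P.fullLabel_node x hγ hσ]; split_ifs with h <;> simp [h]

theorem exists_fullLabel_eq (x : P.Leaf → Bool) {σ : List ℕ} (hσ : P.InTree σ) :
    ∃ b, P.fullLabel x σ = some b := by
  by_cases h0 : P.rank σ = 0
  · exact ⟨_, P.fullLabel_leaf x ⟨σ, hσ, h0⟩⟩
  · rw [P.fullLabel_node x h0 ⟨hσ, rfl⟩]; split_ifs <;> simp

variable {P}

theorem SubBelow.trans {β : Ordinal.{0}} {f g h : Labelling} (hfg : P.SubBelow β f g)
    (hgh : P.SubBelow β g h) : P.SubBelow β f h :=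
  fun σ hσ hr b hb => hgh σ hσ hr b (hfg σ hσ hr b hb)

theorem SubBelow.mono {β γ : Ordinal.{0}} {f g : Labelling} (h : P.SubBelow β f g)
    (hγ : γ ≤ β) : P.SubBelow γ f g :=
  fun σ hσ hr b hb => h σ hσ (hr.trans_le hγ) b hb

theorem SubBelow.eq_of_ne_none {β : Ordinal.{0}} {f g : Labelling} (h : P.SubBelow β f g)
    {σ : List ℕ} (hσ : P.InTree σ) (hr : P.rank σ < β) (hd : f σ ≠ none) : g σ = f σ := by
  obtain ⟨b, hb⟩ := Option.ne_none_iff_exists'.1 hd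
  rw [hb, h σ hσ hr b hb]

theorem subBelow_add_one_iff {γ : Ordinal.{0}} {f g : Labelling} :
    P.SubBelow (γ + 1) f g ↔
      P.SubBelow γ f g ∧ ∀ σ ∈ P.level γ, f σ ≠ none → g σ = f σ := by
  refine ⟨fun h => ⟨h.mono (Order.le_succ γ), fun σ hσ =>
    h.eq_of_ne_none hσ.1 (hσ.2.trans_lt (Order.lt_succ γ))⟩, fun ⟨hlt, heq⟩ σ hσ hr b hb => ?_⟩
  rcases (Order.lt_add_one_iff.1 hr).eq_or_lt with hr | hr
  · rw [heq σ ⟨hσ, hr⟩ (by simp [hb]), hb]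
  · exact hlt σ hσ hr b hb

end Presentation

/-! ### The recursive description of the approximations -/

namespace Presentation

variable {α : Ordinal.{0}} (P : Presentation α)

/-- The lengths of the proper initial segments `s` of `t` with `T^s_β ⊆ T^t_β`. -/
noncomputable def stages (β : Ordinal.{0}) (t : List Bool) : Finset ℕ :=
  P.preds β t.length (fun i => P.approx (t.take i)) (P.approx t)

/-- The length of the longest proper initial segment `s` of `t` with `T^s_β ⊆ T^t_β`, and `0` if
there is none. -/
noncomputable def lastStage (β : Ordinal.{0}) (t : List Bool) : ℕ :=
  (P.stages β t).sup id

/-- The labelling `T^s` on which the labels of rank `β` in `T^t` are modelled. -/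
noncomputable def prevLabel (β : Ordinal.{0}) (t : List Bool) : Labelling :=
  P.approx (t.take (P.lastStage β t))

/-- There are enough `s ≺ t` with `T^s_β ⊆ T^t_β` for some nodes of rank `β` to be labelled by
`T^t`. -/
def Active (β : Ordinal.{0}) (t : List Bool) : Prop :=
  P.code β < (P.stages β t).card

/-- The node `τ` of rank `β` requires attention at `t`. -/
def Attends (β : Ordinal.{0}) (t : List Bool) (τ : List ℕ) : Prop :=
  Attention (P.prevLabel β t) (P.approx t) τ

theorem mem_preds {β : Ordinal.{0}} {l : ℕ} {prev : ℕ → Labelling} {cur : Labelling} {i : ℕ} :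
    i ∈ P.preds β l prev cur ↔ i < l ∧ P.SubBelow β (prev i) cur := by
  simp [preds]

theorem mem_stages {β : Ordinal.{0}} {t : List Bool} {i : ℕ} :
    i ∈ P.stages β t ↔ i < t.length ∧ P.SubBelow β (P.approx (t.take i)) (P.approx t) :=
  P.mem_preds

variable {P} in
theorem Active.lastStage_mem {β : Ordinal.{0}} {t : List Bool} (h : P.Active β t) :
    P.lastStage β t ∈ P.stages β t := by
  obtain ⟨i, hi, heq⟩ := Finset.exists_mem_eq_sup _ (Finset.card_pos.1 (Nat.zero_lt_of_lt h)) id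
  rwa [lastStage, heq]

theorem labelStep_congr {t : List Bool} {prev prev' : ℕ → Labelling} {cur cur' : Labelling}
    {σ : List ℕ} (hprev : ∀ i < t.length, prev i = prev' i)
    (hcur : ∀ ρ, P.rank ρ < P.rank σ → cur ρ = cur' ρ) :
    P.labelStep t prev cur σ = P.labelStep t prev' cur' σ := by
  classical
  unfold labelStep
  by_cases hσ : P.InTree σ
  swap
  · rw [if_pos hσ, if_pos hσ]
  rw [if_neg (not_not.2 hσ), if_neg (not_not.2 hσ)]
  by_cases h0 : P.rank σ = 0
  · rw [if_pos h0, if_pos h0]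
  rw [if_neg h0, if_neg h0]
  have hchild : ∀ τ ∈ P.level (P.rank σ), ∀ k, cur (τ ++ [k]) = cur' (τ ++ [k]) := fun τ hτ k =>
    hcur _ (Ladder.rank_append_lt_of_mem_level h0 hτ k)
  have hpreds : P.preds (P.rank σ) t.length prev cur = P.preds (P.rank σ) t.length prev' cur' := by
    ext i
    rw [mem_preds, mem_preds]
    refine and_congr_right fun hi => ?_
    rw [hprev i hi]
    exact forall₃_congr fun ρ _ hρ => by rw [hcur ρ hρ]
  have hatt : ∀ s, ∀ τ ∈ P.level (P.rank σ), (Attention s cur τ ↔ Attention s cur' τ) :=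
    fun s τ hτ => by simp only [Attention, hchild τ hτ]
  rw [hpreds]
  by_cases hcard : (P.preds (P.rank σ) t.length prev' cur').card ≤ P.code (P.rank σ)
  · rw [if_pos hcard, if_pos hcard]
  rw [if_neg hcard, if_neg hcard]
  obtain ⟨i, hi, hi'⟩ := Finset.exists_mem_eq_sup (P.preds (P.rank σ) t.length prev' cur')
    (Finset.card_pos.1 (by omega)) id
  rw [hi', id, hprev i (P.mem_preds.1 hi).1]
  have hσ' : σ ∈ P.level (P.rank σ) := ⟨hσ, rfl⟩
  have hearlier : (∃ τ ∈ P.level (P.rank σ), P.pos τ < P.pos σ ∧ Attention (prev' i) cur τ) ↔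
      ∃ τ ∈ P.level (P.rank σ), P.pos τ < P.pos σ ∧ Attention (prev' i) cur' τ :=
    exists_congr fun τ => and_congr_right fun hτ => and_congr_right fun _ => hatt _ τ hτ
  refine if_congr hearlier rfl (if_congr (hatt _ σ hσ') ?_ rfl)
  simp only [hchild σ hσ']

theorem approx_eq_labelStep (t : List Bool) (σ : List ℕ) :
    P.approx t σ = P.labelStep t (fun i => P.approx (t.take i)) (P.approx t) σ := by
  conv_lhs => rw [approx, labelFrom]
  refine P.labelStep_congr (fun i hi => if_pos hi) fun ρ hρ => ?_
  rw [if_pos hρ, approx]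

theorem approx_of_not_inTree (t : List Bool) {σ : List ℕ} (hσ : ¬ P.InTree σ) :
    P.approx t σ = none := by
  rw [approx_eq_labelStep, labelStep, if_pos hσ]

theorem approx_leaf (t : List Bool) {σ : List ℕ} (hσ : σ ∈ P.level 0) :
    P.approx t σ = t[P.pos σ]? := by
  rw [approx_eq_labelStep, labelStep, if_neg (not_not.2 hσ.1), if_pos hσ.2]

open Classical in
theorem approx_node (t : List Bool) {γ : Ordinal.{0}} (hγ : γ ≠ 0) {σ : List ℕ}
    (hσ : σ ∈ P.level γ) : P.approx t σ =
      if P.Active γ t ∧ ∀ τ ∈ P.level γ, P.pos τ < P.pos σ → ¬ P.Attends γ t τ then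
        if P.Attends γ t σ then
          if ∃ k, P.approx t (σ ++ [k]) = some true then some false else some true
        else P.prevLabel γ t σ
      else none := by
  obtain ⟨hσ, rfl⟩ := hσ
  rw [approx_eq_labelStep, labelStep, if_neg (not_not.2 hσ), if_neg hγ]
  by_cases hact : P.Active (P.rank σ) t
  swap
  · exact (if_pos (not_lt.1 hact)).trans (if_neg fun h => hact h.1).symm
  refine (if_neg (not_le.2 hact)).trans ?_
  by_cases hearlier : ∃ τ ∈ P.level (P.rank σ), P.pos τ < P.pos σ ∧ P.Attends (P.rank σ) t τ
  · refine (if_pos hearlier).trans (if_neg ?_).symm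
    obtain ⟨τ, hτ, hlt, ha⟩ := hearlier
    exact fun h => h.2 τ hτ hlt ha
  · refine (if_neg hearlier).trans (if_pos ⟨hact, ?_⟩).symm
    exact fun τ hτ hlt ha => hearlier ⟨τ, hτ, hlt, ha⟩

section Node

variable {P} {t : List Bool} {γ : Ordinal.{0}} {σ : List ℕ}

theorem approx_ne_none_iff (hγ : γ ≠ 0) (hσ : σ ∈ P.level γ) :
    P.approx t σ ≠ none ↔
      P.Active γ t ∧ ∀ τ ∈ P.level γ, P.pos τ < P.pos σ → ¬ P.Attends γ t τ := by
  rw [P.approx_node t hγ hσ]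
  split_ifs with hdef hatt hchild
  · exact iff_of_true (by simp) hdef
  · exact iff_of_true (by simp) hdef
  · exact iff_of_true (fun hn => hatt (Or.inl hn)) hdef
  · exact iff_of_false (by simp) hdef

theorem approx_eq_prevLabel (hγ : γ ≠ 0) (hσ : σ ∈ P.level γ) (hd : P.approx t σ ≠ none)
    (hatt : ¬ P.Attends γ t σ) : P.approx t σ = P.prevLabel γ t σ := by
  rw [P.approx_node t hγ hσ, if_pos ((approx_ne_none_iff hγ hσ).1 hd), if_neg hatt]

open Classical in
theorem approx_eq_of_attends (hγ : γ ≠ 0) (hσ : σ ∈ P.level γ) (hd : P.approx t σ ≠ none)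
    (hatt : P.Attends γ t σ) : P.approx t σ =
      if ∃ k, P.approx t (σ ++ [k]) = some true then some false else some true := by
  rw [P.approx_node t hγ hσ, if_pos ((approx_ne_none_iff hγ hσ).1 hd), if_pos hatt]

theorem approx_eq_false_of_child (hγ : γ ≠ 0) (hσ : σ ∈ P.level γ) (hd : P.approx t σ ≠ none)
    {k : ℕ} (hk : P.approx t (σ ++ [k]) = some true) : P.approx t σ = some false := by
  by_cases hatt : P.Attends γ t σ
  · rw [approx_eq_of_attends hγ hσ hd hatt, if_pos ⟨k, hk⟩]
  · rw [approx_eq_prevLabel hγ hσ hd hatt]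
    rcases hv : P.prevLabel γ t σ with _ | _ | _
    · exact absurd (Or.inl hv) hatt
    · rfl
    · exact absurd (Or.inr ⟨hv, k, hk⟩) hatt

theorem exists_child_or_prevLabel_eq_false (hγ : γ ≠ 0) (hσ : σ ∈ P.level γ)
    (hf : P.approx t σ = some false) :
    (∃ k, P.approx t (σ ++ [k]) = some true) ∨ P.prevLabel γ t σ = some false := by
  have hd : P.approx t σ ≠ none := by simp [hf]
  by_cases hatt : P.Attends γ t σ
  · rw [approx_eq_of_attends hγ hσ hd hatt] at hf
    exact Or.inl (by_contra fun h => by simp [h] at hf)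
  · exact Or.inr (approx_eq_prevLabel hγ hσ hd hatt ▸ hf)

theorem approx_ne_none_of_pos_le (hγ : γ ≠ 0) {τ : List ℕ} (hσ : σ ∈ P.level γ)
    (hτ : τ ∈ P.level γ) (hle : P.pos τ ≤ P.pos σ) (hd : P.approx t σ ≠ none) :
    P.approx t τ ≠ none := by
  obtain ⟨hact, hearlier⟩ := (approx_ne_none_iff hγ hσ).1 hd
  exact (approx_ne_none_iff hγ hτ).2 ⟨hact, fun ρ hρ hlt => hearlier ρ hρ (hlt.trans_le hle)⟩

end Node

theorem approx_nil (σ : List ℕ) : P.approx [] σ = none := by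
  by_cases hσ : P.InTree σ
  · by_cases h0 : P.rank σ = 0
    · simp [P.approx_leaf [] ⟨hσ, h0⟩]
    · by_contra hd
      have hlast := (P.mem_stages.1 ((approx_ne_none_iff h0 ⟨hσ, rfl⟩).1 hd).1.lastStage_mem).1
      exact absurd hlast (by simp)
  · exact P.approx_of_not_inTree _ hσ

theorem finite_level_support {γ : Ordinal.{0}} (hγ : γ < α) (t : List Bool) :
    {σ ∈ P.level γ | P.approx t σ ≠ none}.Finite := by
  rcases eq_or_ne γ 0 with rfl | h0
  · refine (P.finite_pos_lt hγ t.length).subset fun σ ⟨hσ, hd⟩ => ⟨hσ, ?_⟩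
    simpa [P.approx_leaf t hσ] using hd
  by_cases hact : P.Active γ t
  · have hlen := (P.mem_stages.1 hact.lastStage_mem).1
    -- The nodes after an unlabelled node of the previous stage remain unlabelled.
    obtain ⟨τ, hτ, hnone⟩ : ∃ τ ∈ P.level γ, P.prevLabel γ t τ = none := by
      by_contra! hall
      exact P.infinite_level hγ ((finite_level_support hγ (t.take (P.lastStage γ t))).subset
        fun σ hσ => ⟨hσ, hall σ hσ⟩)
    refine (P.finite_pos_lt hγ (P.pos τ + 1)).subset fun σ ⟨hσ, hd⟩ => ⟨hσ, ?_⟩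
    by_contra! hlt
    exact ((approx_ne_none_iff h0 hσ).1 hd).2 τ hτ hlt (Or.inl hnone)
  · refine Set.finite_empty.subset fun σ ⟨hσ, hd⟩ => ?_
    exact hact ((approx_ne_none_iff h0 hσ).1 hd).1
termination_by t.length
decreasing_by simpa using hlen

theorem finite_support (t : List Bool) :
    {σ | P.InTree σ ∧ P.rank σ < α ∧ P.approx t σ ≠ none}.Finite := by
  have hranks : (insert 0 {γ | γ < α ∧ P.code γ < t.length}).Finite :=
    (P.finite_code_lt t.length).insert 0
  refine (hranks.biUnion (t := fun γ => {σ | γ < α ∧ σ ∈ P.level γ ∧ P.approx t σ ≠ none})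
    fun γ _ => ?_).subset ?_
  · by_cases hγ : γ < α
    · simpa only [hγ, true_and] using P.finite_level_support hγ t
    · simp [hγ]
  rintro σ ⟨hσ, hr, hd⟩
  refine Set.mem_biUnion (x := P.rank σ) ?_ ⟨hr, ⟨hσ, rfl⟩, hd⟩
  rcases eq_or_ne (P.rank σ) 0 with h0 | h0
  · exact Or.inl h0
  · have hact : P.Active (P.rank σ) t := ((approx_ne_none_iff h0 ⟨hσ, rfl⟩).1 hd).1
    have hcard : (P.stages (P.rank σ) t).card ≤ t.length := by
      simpa using Finset.card_le_card fun i hi => Finset.mem_range.2 (P.mem_stages.1 hi).1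
    exact Or.inr ⟨hr, hact.trans_le hcard⟩

/-! ### True stages of a point -/

/-- The initial segment of length `n` of `x`. -/
noncomputable def initSeg (x : P.Leaf → Bool) (n : ℕ) : List Bool :=
  open Classical in (List.range n).map fun j => decide (∃ l : P.Leaf, P.pos l = j ∧ x l = true)

/-- The labelling `T^s`, where `s` is the initial segment of length `j` of `x`. -/
noncomputable def approxAt (x : P.Leaf → Bool) (j : ℕ) : Labelling :=
  P.approx (P.initSeg x j)

/-- The `β`-true stages of `x`: the lengths of the initial segments `s` of `x` with
`T^s_β ⊆ T^x_β`. -/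
def IsTrueStage (β : Ordinal.{0}) (x : P.Leaf → Bool) (i : ℕ) : Prop :=
  P.SubBelow β (P.approxAt x i) (P.fullLabel x)

/-- Along the `β`-true stages of `x`, the approximations increase, and they converge to `T^x` on the
nodes of rank below `β`. -/
structure GoodStages (β : Ordinal.{0}) (x : P.Leaf → Bool) : Prop where
  sub : ∀ i j, i ≤ j → P.IsTrueStage β x i → P.IsTrueStage β x j →
    P.SubBelow β (P.approxAt x i) (P.approxAt x j)
  frequently : ∃ᶠ i in atTop, P.IsTrueStage β x i
  eventually_eq : ∀ σ, P.InTree σ → P.rank σ < β →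
    ∀ᶠ i in atTop, P.IsTrueStage β x i → P.approxAt x i σ = P.fullLabel x σ

@[simp] theorem length_initSeg (x : P.Leaf → Bool) (n : ℕ) : (P.initSeg x n).length = n := by
  simp [initSeg]

theorem take_initSeg (x : P.Leaf → Bool) {i n : ℕ} (h : i ≤ n) :
    (P.initSeg x n).take i = P.initSeg x i := by
  rw [initSeg, ← List.map_take, List.take_range, min_eq_left h, initSeg]

theorem approxAt_zero (x : P.Leaf → Bool) (σ : List ℕ) : P.approxAt x 0 σ = none := by
  simp [approxAt, initSeg, P.approx_nil]

theorem approxAt_leaf (hα : 0 < α) (x : P.Leaf → Bool) (n : ℕ) (l : P.Leaf) :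
    P.approxAt x n l = if P.pos l < n then some (x l) else none := by
  rw [approxAt, P.approx_leaf _ l.2]
  split_ifs with h
  · have hbit : (∃ l' : P.Leaf, P.pos l' = P.pos l ∧ x l' = true) ↔ x l = true := by
      refine ⟨fun ⟨l', hpos, hl'⟩ => ?_, fun hl => ⟨l, rfl, hl⟩⟩
      rwa [Subtype.ext (P.pos_injOn hα l'.2 l.2 hpos)] at hl'
    simp [initSeg, h, hbit]
  · simp [initSeg, h]

theorem isTrueStage_zero (β : Ordinal.{0}) (x : P.Leaf → Bool) : P.IsTrueStage β x 0 := by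
  intro σ _ _ b h
  simp [P.approxAt_zero] at h

theorem mem_stages_initSeg {β : Ordinal.{0}} {x : P.Leaf → Bool} {i j : ℕ} :
    i ∈ P.stages β (P.initSeg x j) ↔
      i < j ∧ P.SubBelow β (P.approxAt x i) (P.approxAt x j) := by
  rw [mem_stages, length_initSeg]
  exact and_congr_right fun h => by rw [P.take_initSeg x h.le, approxAt, approxAt]

theorem prevLabel_initSeg (β : Ordinal.{0}) (x : P.Leaf → Bool) (j : ℕ) :
    P.prevLabel β (P.initSeg x j) = P.approxAt x (P.lastStage β (P.initSeg x j)) := by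
  rw [prevLabel, P.take_initSeg x, approxAt]
  exact Finset.sup_le fun _ hi => (P.mem_stages_initSeg.1 hi).1.le

namespace GoodStages

variable {P} {γ : Ordinal.{0}} {x : P.Leaf → Bool}

theorem mem_stages (H : P.GoodStages γ x) {i j : ℕ} (hj : P.IsTrueStage γ x j) :
    i ∈ P.stages γ (P.initSeg x j) ↔ i < j ∧ P.IsTrueStage γ x i := by
  rw [mem_stages_initSeg]
  exact and_congr_right fun h => ⟨fun hsub => hsub.trans hj, fun hi => H.sub i j h.le hi hj⟩

theorem le_lastStage (H : P.GoodStages γ x) {i j : ℕ} (hi : P.IsTrueStage γ x i)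
    (hj : P.IsTrueStage γ x j) (hij : i < j) : i ≤ P.lastStage γ (P.initSeg x j) :=
  Finset.le_sup (f := id) ((H.mem_stages hj).2 ⟨hij, hi⟩)

theorem lastStage_spec (H : P.GoodStages γ x) {j : ℕ} (hj : P.IsTrueStage γ x j) (hpos : 0 < j) :
    P.lastStage γ (P.initSeg x j) < j ∧
      P.IsTrueStage γ x (P.lastStage γ (P.initSeg x j)) := by
  obtain ⟨i, hi, heq⟩ := Finset.exists_mem_eq_sup (P.stages γ (P.initSeg x j))
    ⟨0, (H.mem_stages hj).2 ⟨hpos, P.isTrueStage_zero γ x⟩⟩ id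
  rw [lastStage, heq]
  exact (H.mem_stages hj).1 hi

theorem eventually_lastStage (H : P.GoodStages γ x) {p : ℕ → Prop}
    (h : ∀ᶠ j in atTop, P.IsTrueStage γ x j → p j) :
    ∀ᶠ j in atTop, P.IsTrueStage γ x j → p (P.lastStage γ (P.initSeg x j)) := by
  obtain ⟨N, hN⟩ := eventually_atTop.1 h
  obtain ⟨i, hNi, hi⟩ := frequently_atTop.1 H.frequently N
  filter_upwards [eventually_gt_atTop i] with j hij hj
  exact hN _ (hNi.trans (H.le_lastStage hi hj hij)) (H.lastStage_spec hj (by omega)).2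

theorem exists_lastStage_eq (H : P.GoodStages γ x) {i : ℕ} (hi : P.IsTrueStage γ x i) :
    ∃ j > i, P.IsTrueStage γ x j ∧ P.lastStage γ (P.initSeg x j) = i := by
  classical
  have hex : ∃ j, i < j ∧ P.IsTrueStage γ x j := frequently_atTop'.1 H.frequently i
  obtain ⟨hij, hj⟩ := Nat.find_spec hex
  refine ⟨Nat.find hex, hij, hj, (H.le_lastStage hi hj hij).antisymm' ?_⟩
  obtain ⟨hlt, hlast⟩ := H.lastStage_spec hj (by omega)
  exact not_lt.1 fun hgt => Nat.find_min hex hlt ⟨hgt, hlast⟩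

open Classical in
theorem active_iff (H : P.GoodStages γ x) {j : ℕ} (hj : P.IsTrueStage γ x j) :
    P.Active γ (P.initSeg x j) ↔ P.code γ < Nat.count (P.IsTrueStage γ x) j := by
  have : P.stages γ (P.initSeg x j) = {i ∈ Finset.range j | P.IsTrueStage γ x i} := by
    ext i
    rw [H.mem_stages hj, Finset.mem_filter, Finset.mem_range]
  rw [Active, this, Nat.count_eq_card_filter_range]

theorem active_mono (H : P.GoodStages γ x) {i j : ℕ} (hi : P.IsTrueStage γ x i)
    (hj : P.IsTrueStage γ x j) (hij : i ≤ j) (hact : P.Active γ (P.initSeg x i)) :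
    P.Active γ (P.initSeg x j) := by
  classical
  exact (H.active_iff hj).2 (((H.active_iff hi).1 hact).trans_le (Nat.count_monotone _ hij))

theorem eventually_active (H : P.GoodStages γ x) :
    ∀ᶠ j in atTop, P.IsTrueStage γ x j → P.Active γ (P.initSeg x j) := by
  classical
  have hinf := Nat.frequently_atTop_iff_infinite.1 H.frequently
  filter_upwards [eventually_ge_atTop (Nat.nth (P.IsTrueStage γ x) (P.code γ + 1))] with j hle hj
  refine (H.active_iff hj).2 (lt_of_lt_of_le (Nat.lt_succ_self _) ?_)
  exact (Nat.count_nth_of_infinite hinf _).symm.trans_le (Nat.count_monotone _ hle)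

section Successor

variable {σ : List ℕ}

theorem fullLabel_child (hγ : γ ≠ 0) (hσ : σ ∈ P.level γ) {j : ℕ} (hj : P.IsTrueStage γ x j)
    {k : ℕ} (hk : P.approxAt x j (σ ++ [k]) = some true) :
    P.fullLabel x (σ ++ [k]) = some true :=
  hj _ (Ladder.inTree_append_of_mem_level hγ hσ k) (Ladder.rank_append_lt_of_mem_level hγ hσ k) _ hk

theorem exists_child_of_eq_false (H : P.GoodStages γ x) (hγ : γ ≠ 0) (hσ : σ ∈ P.level γ) {j : ℕ}
    (hj : P.IsTrueStage γ x j) (hf : P.approxAt x j σ = some false) :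
    ∃ k, P.approxAt x j (σ ++ [k]) = some true := by
  induction j using Nat.strong_induction_on with
  | _ j ih =>
  rcases Nat.eq_zero_or_pos j with rfl | hpos
  · simp [P.approxAt_zero] at hf
  rcases exists_child_or_prevLabel_eq_false hγ hσ hf with hchild | hprev
  · exact hchild
  · obtain ⟨hlt, hlast⟩ := H.lastStage_spec hj hpos
    rw [P.prevLabel_initSeg] at hprev
    obtain ⟨k, hk⟩ := ih _ hlt hlast hprev
    exact ⟨k, H.sub _ _ hlt.le hlast hj _ (Ladder.inTree_append_of_mem_level hγ hσ k)
      (Ladder.rank_append_lt_of_mem_level hγ hσ k) _ hk⟩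

theorem fullLabel_eq_false (H : P.GoodStages γ x) (hγ : γ ≠ 0) (hσ : σ ∈ P.level γ) {j : ℕ}
    (hj : P.IsTrueStage γ x j) (hf : P.approxAt x j σ = some false) :
    P.fullLabel x σ = some false := by
  obtain ⟨k, hk⟩ := H.exists_child_of_eq_false hγ hσ hj hf
  exact (P.fullLabel_eq_false_iff x hγ hσ).2 ⟨k, fullLabel_child hγ hσ hj hk⟩

theorem not_attends_of_prevLabel_eq (hγ : γ ≠ 0) (hσ : σ ∈ P.level γ) {j : ℕ}
    (hj : P.IsTrueStage γ x j) (hprev : P.prevLabel γ (P.initSeg x j) σ = P.fullLabel x σ) :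
    ¬ P.Attends γ (P.initSeg x j) σ := by
  rintro (hnone | ⟨htrue, k, hk⟩)
  · obtain ⟨b, hb⟩ := P.exists_fullLabel_eq x hσ.1
    rw [hprev, hb] at hnone
    cases hnone
  · rw [hprev, P.fullLabel_eq_true_iff x hγ hσ] at htrue
    exact htrue ⟨k, fullLabel_child hγ hσ hj hk⟩

theorem approxAt_persists (H : P.GoodStages γ x) (hγ : γ ≠ 0) (hσ : σ ∈ P.level γ) {i : ℕ}
    (hi : P.IsTrueStage γ x i) (hd : P.approxAt x i σ ≠ none)
    (hatt : ∀ j > i, P.IsTrueStage γ x j → ∀ τ ∈ P.level γ, P.pos τ ≤ P.pos σ →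
      P.prevLabel γ (P.initSeg x j) τ = P.approxAt x i τ → ¬ P.Attends γ (P.initSeg x j) τ)
    {j : ℕ} (hij : i ≤ j) (hj : P.IsTrueStage γ x j) {τ : List ℕ} (hτ : τ ∈ P.level γ)
    (hle : P.pos τ ≤ P.pos σ) : P.approxAt x j τ = P.approxAt x i τ := by
  induction j using Nat.strong_induction_on generalizing τ with
  | _ j ih =>
  rcases hij.eq_or_lt with rfl | hlt
  · rfl
  obtain ⟨hlast, hlast'⟩ := H.lastStage_spec hj (by omega)
  have hprev : ∀ ρ ∈ P.level γ, P.pos ρ ≤ P.pos σ →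
      P.prevLabel γ (P.initSeg x j) ρ = P.approxAt x i ρ := fun ρ hρ hρσ => by
    rw [P.prevLabel_initSeg]
    exact ih _ hlast (H.le_lastStage hi hj hlt) hlast' hρ hρσ
  have hna : ∀ ρ ∈ P.level γ, P.pos ρ ≤ P.pos σ → ¬ P.Attends γ (P.initSeg x j) ρ :=
    fun ρ hρ hρσ => hatt j hlt hj ρ hρ hρσ (hprev ρ hρ hρσ)
  have hdef : P.approxAt x j τ ≠ none := (approx_ne_none_iff hγ hτ).2
    ⟨H.active_mono hi hj hij ((approx_ne_none_iff hγ hσ).1 hd).1,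
      fun ρ hρ hρτ => hna ρ hρ (hρτ.le.trans hle)⟩
  exact (approx_eq_prevLabel hγ hτ hdef (hna τ hτ hle)).trans (hprev τ hτ hle)

theorem sub_add_one (H : P.GoodStages γ x) (hγ : γ ≠ 0) {i j : ℕ} (hij : i ≤ j)
    (hi : P.IsTrueStage (γ + 1) x i) (hj : P.IsTrueStage γ x j) :
    P.SubBelow (γ + 1) (P.approxAt x i) (P.approxAt x j) := by
  obtain ⟨hi', heq⟩ := subBelow_add_one_iff.1 hi
  refine subBelow_add_one_iff.2 ⟨H.sub i j hij hi' hj, fun σ hσ hd => ?_⟩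
  refine H.approxAt_persists hγ hσ hi' hd (fun k _ hk τ hτ hle hprev => ?_) hij hj hσ le_rfl
  refine not_attends_of_prevLabel_eq hγ hτ hk (hprev.trans (heq τ hτ ?_).symm)
  exact approx_ne_none_of_pos_le hγ hσ hτ hle hd

theorem eventually_approxAt_eq (H : P.GoodStages γ x) (hγ : γ ≠ 0) (hγα : γ < α)
    (hσ : σ ∈ P.level γ) :
    ∀ᶠ j in atTop, P.IsTrueStage γ x j → P.approxAt x j σ = P.fullLabel x σ := by
  induction h : P.pos σ using Nat.strong_induction_on generalizing σ with
  | _ n ih =>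
  have hearlier : ∀ᶠ j in atTop, ∀ τ ∈ {τ ∈ P.level γ | P.pos τ < n},
      P.IsTrueStage γ x j → P.prevLabel γ (P.initSeg x j) τ = P.fullLabel x τ := by
    refine (eventually_all_finite (P.finite_pos_lt hγα n)).2 fun τ ⟨hτ, hlt⟩ => ?_
    simpa only [P.prevLabel_initSeg] using H.eventually_lastStage (ih _ hlt hτ rfl)
  have hdef : ∀ᶠ j in atTop, P.IsTrueStage γ x j → P.approxAt x j σ ≠ none := by
    filter_upwards [hearlier, H.eventually_active] with j hprev hact hj
    exact (approx_ne_none_iff hγ hσ).2 ⟨hact hj, fun τ hτ hlt =>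
      not_attends_of_prevLabel_eq hγ hτ hj (hprev τ ⟨hτ, h ▸ hlt⟩ hj)⟩
  obtain ⟨_ | _, hb⟩ := P.exists_fullLabel_eq x hσ.1
  · obtain ⟨k, hk⟩ := (P.fullLabel_eq_false_iff x hγ hσ).1 hb
    filter_upwards [hdef, H.eventually_eq _ (Ladder.inTree_append_of_mem_level hγ hσ k)
      (Ladder.rank_append_lt_of_mem_level hγ hσ k)] with j hd hchild hj
    rw [hb]
    exact approx_eq_false_of_child hγ hσ (hd hj) ((hchild hj).trans hk)
  · filter_upwards [hdef] with j hd hj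
    rcases hv : P.approxAt x j σ with _ | _ | _
    · exact absurd hv (hd hj)
    · rw [H.fullLabel_eq_false hγ hσ hj hv]
    · exact hb.symm

theorem exists_last_undefined (H : P.GoodStages γ x) (hγ : γ ≠ 0) (hγα : γ < α)
    (hσ : σ ∈ P.level γ) : ∃ j, P.IsTrueStage γ x j ∧ P.approxAt x j σ = none ∧
      ∀ i > j, P.IsTrueStage γ x i → P.approxAt x i σ ≠ none := by
  set S := {j | P.IsTrueStage γ x j ∧ P.approxAt x j σ = none}
  have hbdd : BddAbove S := by
    obtain ⟨N, hN⟩ := eventually_atTop.1 (H.eventually_approxAt_eq hγ hγα hσ)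
    refine ⟨N, fun j ⟨hj, hnone⟩ => ?_⟩
    by_contra! hlt
    obtain ⟨b, hb⟩ := P.exists_fullLabel_eq x hσ.1
    rw [hN j hlt.le hj, hb] at hnone
    cases hnone
  have hmem : sSup S ∈ S :=
    Nat.sSup_mem ⟨0, P.isTrueStage_zero γ x, P.approxAt_zero x σ⟩ hbdd
  exact ⟨sSup S, hmem.1, hmem.2, fun i hlt hi hnone =>
    hlt.not_ge (le_csSup hbdd ⟨hi, hnone⟩)⟩

theorem exists_stage_add_one (H : P.GoodStages γ x) (hγ : γ ≠ 0) (hγα : γ < α) {ρ : List ℕ}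
    (hρ : ρ ∈ P.level γ) : ∃ j, P.IsTrueStage (γ + 1) x j ∧ P.approxAt x j ρ = none ∧
      ∀ τ ∈ P.level γ, P.pos τ < P.pos ρ → P.approxAt x j τ ≠ none := by
  obtain ⟨j, hj, hnone, hlater⟩ := H.exists_last_undefined hγ hγα hρ
  have hatt : ∀ i > j, P.IsTrueStage γ x i → ∀ τ ∈ P.level γ, P.pos τ < P.pos ρ →
      ¬ P.Attends γ (P.initSeg x i) τ := fun i hij hi =>
    ((approx_ne_none_iff hγ hρ).1 (hlater i hij hi)).2
  refine ⟨j, subBelow_add_one_iff.2 ⟨hj, fun σ hσ hd => ?_⟩, hnone, fun τ hτ hlt hτnone => ?_⟩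
  · have hlt : P.pos σ < P.pos ρ := by
      by_contra! hle
      exact approx_ne_none_of_pos_le hγ hσ hρ hle hd hnone
    obtain ⟨i, hi, hlim, hij⟩ := (H.frequently.and_eventually
      ((H.eventually_approxAt_eq hγ hγα hσ).and (eventually_ge_atTop j))).exists
    rw [← hlim hi]
    exact H.approxAt_persists hγ hσ hj hd
      (fun k hk hk' τ hτ hle _ => hatt k hk hk' τ hτ (hle.trans_lt hlt)) hij hi hσ le_rfl
  · obtain ⟨i, hij, hi, hlast⟩ := H.exists_lastStage_eq hj
    refine hatt i hij hi τ hτ hlt (Or.inl ?_)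
    rw [P.prevLabel_initSeg, hlast, hτnone]

theorem frequently_add_one (H : P.GoodStages γ x) (hγ : γ ≠ 0) (hγα : γ < α) :
    ∃ᶠ i in atTop, P.IsTrueStage (γ + 1) x i := by
  choose ρ hρ hpos using P.exists_pos_eq hγα
  choose f htrue hnone hdef using fun n => H.exists_stage_add_one hγ hγα (hρ n)
  have hne : ∀ m n, m < n → f m ≠ f n := fun m n hmn heq =>
    hdef n (ρ m) (hρ m) (by rwa [hpos, hpos]) (heq ▸ hnone m)
  exact Nat.frequently_atTop_iff_infinite.2
    (Set.infinite_of_injective_forall_mem (.of_lt_imp_ne hne) htrue)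

theorem add_one (H : P.GoodStages γ x) (hγ : γ ≠ 0) (hγα : γ < α) : P.GoodStages (γ + 1) x where
  sub _ _ hij hi hj := H.sub_add_one hγ hij hi (hj.mono (Order.le_succ γ))
  frequently := H.frequently_add_one hγ hγα
  eventually_eq σ hσ hr := by
    have hlim : ∀ᶠ j in atTop, P.IsTrueStage γ x j → P.approxAt x j σ = P.fullLabel x σ := by
      rcases (Order.lt_add_one_iff.1 hr).eq_or_lt with hr | hr
      · exact H.eventually_approxAt_eq hγ hγα ⟨hσ, hr⟩
      · exact H.eventually_eq σ hσ hr
    exact hlim.mono fun j h hj => h (hj.mono (Order.le_succ γ))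

end Successor

end GoodStages

theorem goodStages_zero (x : P.Leaf → Bool) : P.GoodStages 0 x where
  sub _ _ _ _ _ _ _ hr := absurd hr not_lt_zero
  frequently := (Eventually.of_forall fun _ _ _ hr => absurd hr not_lt_zero).frequently
  eventually_eq _ _ hr := absurd hr not_lt_zero

theorem goodStages_one (hα : 0 < α) (x : P.Leaf → Bool) : P.GoodStages 1 x where
  sub i j hij _ _ σ hσ hr b hb := by
    have hleaf n := P.approxAt_leaf hα x n ⟨σ, hσ, Order.lt_one_iff.1 hr⟩
    simp only [hleaf, Option.ite_none_right_eq_some] at hb ⊢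
    exact ⟨hb.1.trans_le hij, hb.2⟩
  frequently := by
    refine (Eventually.of_forall fun i σ hσ hr b hb => ?_).frequently
    have h0 := Order.lt_one_iff.1 hr
    have hleaf := P.approxAt_leaf hα x i ⟨σ, hσ, h0⟩
    simp only [hleaf, Option.ite_none_right_eq_some] at hb
    exact (P.fullLabel_leaf x ⟨σ, hσ, h0⟩).trans hb.2
  eventually_eq σ hσ hr := by
    have h0 := Order.lt_one_iff.1 hr
    filter_upwards [eventually_gt_atTop (P.pos σ)] with i hi _
    exact (P.approxAt_leaf hα x i ⟨σ, hσ, h0⟩).trans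
      ((if_pos hi).trans (P.fullLabel_leaf x ⟨σ, hσ, h0⟩).symm)

section Limit

variable {P} {δ : Ordinal.{0}} {x : P.Leaf → Bool}

theorem isTrueStage_of_forall_lt (hδ : Order.IsSuccLimit δ) {i : ℕ}
    (h : ∀ β < δ, P.IsTrueStage β x i) : P.IsTrueStage δ x i := fun σ hσ hr =>
  h (P.rank σ + 1) (hδ.succ_lt hr) σ hσ (Order.lt_succ _)

open Classical in
theorem isTrueStage_of_count_le (H : ∀ γ < δ, P.GoodStages γ x) (hδ : Order.IsSuccLimit δ)
    {β : Ordinal.{0}} (hβ : β ≠ 0) {i : ℕ} (hi : P.IsTrueStage β x i)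
    (hcode : ∀ γ, β ≤ γ → γ < δ → Nat.count (P.IsTrueStage β x) i ≤ P.code γ) :
    P.IsTrueStage δ x i := by
  refine isTrueStage_of_forall_lt hδ fun γ hγ => ?_
  induction γ using WellFoundedLT.induction with
  | _ γ ih =>
  intro σ hσ hr b hb
  by_cases hrβ : P.rank σ < β
  · exact hi σ hσ hrβ b hb
  have hβr := not_lt.1 hrβ
  have hr0 : P.rank σ ≠ 0 := (hβ.bot_lt.trans_le hβr).ne'
  have hd : P.approxAt x i σ ≠ none := by simp [hb]
  have hact := ((approx_ne_none_iff hr0 ⟨hσ, rfl⟩).1 hd).1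
  rw [(H _ (hr.trans hγ)).active_iff (ih _ hr (hr.trans hγ))] at hact
  exact absurd (hact.trans_le (Nat.count_mono_left fun k _ hk => hk.mono hβr))
    (hcode _ hβr (hr.trans hγ)).not_gt

theorem goodStages_limit (hδ : Order.IsSuccLimit δ) (hδα : δ ≤ α)
    (H : ∀ β < δ, P.GoodStages β x) : P.GoodStages δ x where
  sub i j hij hi hj σ hσ hr :=
    (H _ (hδ.succ_lt hr)).sub i j hij (hi.mono (hδ.succ_lt hr).le) (hj.mono (hδ.succ_lt hr).le)
      σ hσ (Order.lt_succ _)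
  frequently := by
    classical
    refine frequently_atTop.2 fun n => ?_
    obtain ⟨β, hβδ, hβ, hcode⟩ := P.exists_forall_le_code hδ hδα n
    -- The `n`-th `β`-true stage is too early for any label of rank in `[β, δ)`.
    have hinf := Nat.frequently_atTop_iff_infinite.1 (H β hβδ).frequently
    refine ⟨Nat.nth (P.IsTrueStage β x) n, Nat.le_nth fun h => absurd h hinf, ?_⟩
    refine isTrueStage_of_count_le H hδ hβ (Nat.nth_mem_of_infinite hinf n) ?_
    rwa [Nat.count_nth_of_infinite hinf]
  eventually_eq σ hσ hr :=
    ((H _ (hδ.succ_lt hr)).eventually_eq σ hσ (Order.lt_succ _)).mono fun _ h hi =>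
      h (hi.mono (hδ.succ_lt hr).le)

end Limit

theorem goodStages (hα : 0 < α) (x : P.Leaf → Bool) (β : Ordinal.{0}) (hβ : β ≤ α) :
    P.GoodStages β x := by
  induction β using WellFoundedLT.induction with
  | _ β ih =>
  rcases Ordinal.zero_or_succ_or_isSuccLimit β with rfl | ⟨γ, rfl⟩ | hlim
  · exact P.goodStages_zero x
  · have hγ : γ < γ + 1 := Order.lt_succ γ
    rw [Order.succ_eq_add_one] at hβ ih ⊢
    rcases eq_or_ne γ 0 with rfl | h0
    · simpa using P.goodStages_one hα x
    · exact (ih γ hγ (hγ.le.trans hβ)).add_one h0 (hγ.trans_le hβ)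
  · exact goodStages_limit hlim hβ fun γ hγ => ih γ hγ (hγ.le.trans hβ)

end Presentation

/-! ### Coding locations -/

theorem Ladder.append_mem_level {α : Ordinal.{0}} {L : Ladder α} {γ : Ordinal.{0}} (hγ : γ < α)
    {σ : List ℕ} (hσ : σ ∈ L.level (γ + 1)) (k : ℕ) : σ ++ [k] ∈ L.level γ :=
  ⟨inTree_append_of_mem_level (Order.succ_ne_bot γ) hσ k, by
    rw [L.rank_append, hσ.2, L.down_succ γ hγ]⟩

namespace Presentation

variable {α : Ordinal.{0}} {P : Presentation α}

theorem star_eq {β : Ordinal.{0}} (h : α = β + 1 + 1) : P.star = β := by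
  subst h
  simp [star]

section TwoStep

variable (hα : α = P.star + 1 + 1)
include hα

theorem pos_of_eq_star : 0 < α :=
  hα ▸ Order.bot_lt_succ _

theorem star_add_one_lt : P.star + 1 < α :=
  (Order.lt_succ _).trans_eq hα.symm

theorem star_lt : P.star < α :=
  (Order.lt_succ _).trans (star_add_one_lt hα)

theorem singleton_mem_level (m : ℕ) : [m] ∈ P.level (P.star + 1) :=
  Ladder.append_mem_level (σ := []) (star_add_one_lt hα) ⟨trivial, hα⟩ m

theorem pair_mem_level (m k : ℕ) : [m, k] ∈ P.level P.star :=
  Ladder.append_mem_level (star_lt hα) (singleton_mem_level hα m) k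

theorem fullLabel_singleton_eq_false_iff {x : P.Leaf → Bool} {m : ℕ} :
    P.fullLabel x [m] = some false ↔ ∃ k, P.fullLabel x [m, k] = some true :=
  P.fullLabel_eq_false_iff x (Order.succ_ne_bot _) (singleton_mem_level hα m)

variable (hstar : P.star ≠ 0)
include hstar

theorem inTree_triple (m k a : ℕ) : P.InTree [m, k, a] :=
  Ladder.inTree_append_of_mem_level hstar (pair_mem_level hα m k) a

theorem rank_triple_lt (m k a : ℕ) : P.rank [m, k, a] < P.star :=
  Ladder.rank_append_lt_of_mem_level hstar (pair_mem_level hα m k) a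

end TwoStep

theorem le_nPoint_iff {x : P.Leaf → Bool} {m : ℕ} :
    (m : ℕ∞) ≤ P.nPoint x ↔ ∀ l < m, P.fullLabel x [l] = some false := by
  refine ⟨fun h l hl => ?_, fun h => le_iSup₂_of_le m h le_rfl⟩
  by_contra hne
  have hle : P.nPoint x ≤ (l : ℕ∞) :=
    iSup₂_le fun n hn => Nat.cast_le.2 (not_lt.1 fun hlt => hne (hn l hlt))
  exact hl.not_ge (Nat.cast_le.1 (h.trans hle))

theorem nPoint_eq {x : P.Leaf → Bool} {m : ℕ} (h : ∀ l < m, P.fullLabel x [l] = some false)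
    (hm : P.fullLabel x [m] = some true) : P.nPoint x = m := by
  refine le_antisymm (not_lt.1 fun hlt => ?_) (le_nPoint_iff.2 h)
  have hle : ((m + 1 : ℕ) : ℕ∞) ≤ P.nPoint x := by exact_mod_cast Order.add_one_le_of_lt hlt
  rw [le_nPoint_iff.1 hle m (Nat.lt_succ_self m)] at hm
  cases hm

theorem kPoint_eq {x : P.Leaf → Bool} {m k : ℕ} (h : P.fullLabel x [m, k] = some true)
    (h' : ∀ i < k, P.fullLabel x [m, i] = some false) : P.kPoint x m = k :=
  IsLeast.csInf_eq ⟨h, fun i hi => not_lt.1 fun hlt => by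
    simp [h' i hlt] at hi⟩

theorem fullLabel_kPoint (hα : α = P.star + 1 + 1) {x : P.Leaf → Bool} {m : ℕ}
    (h : P.fullLabel x [m] = some false) : P.fullLabel x [m, P.kPoint x m] = some true :=
  Nat.sInf_mem ((fullLabel_singleton_eq_false_iff hα).1 h)

theorem fullLabel_of_lt_kPoint (hα : α = P.star + 1 + 1) {x : P.Leaf → Bool} {m k : ℕ}
    (hk : k < P.kPoint x m) : P.fullLabel x [m, k] = some false := by
  have hne : P.fullLabel x [m, k] ≠ some true := Nat.notMem_of_lt_sInf hk
  obtain ⟨_ | _, hb⟩ := P.exists_fullLabel_eq x (pair_mem_level hα m k).1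
  exacts [hb, absurd hb hne]

theorem kString_eq {t : List Bool} {m k : ℕ} (h : ¬ ∃ a, P.approx t [m, k, a] = some true)
    (h' : ∀ i < k, ∃ a, P.approx t [m, i, a] = some true) : P.kString t m = k :=
  IsLeast.csInf_eq ⟨h, fun i hi => not_lt.1 fun hlt => hi (h' i hlt)⟩

section Convergence

variable (hα : α = P.star + 1 + 1) (hstar : P.star ≠ 0) {x : P.Leaf → Bool}
include hα hstar

theorem not_exists_approx_kPoint {t : List Bool} {l : ℕ}
    (ht : P.SubBelow P.star (P.approx t) (P.fullLabel x)) (hl : P.fullLabel x [l] = some false) :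
    ¬ ∃ a, P.approx t [l, P.kPoint x l, a] = some true := fun ⟨a, ha⟩ =>
  (P.fullLabel_eq_true_iff x hstar (pair_mem_level hα l _)).1 (fullLabel_kPoint hα hl)
    ⟨a, ht _ (inTree_triple hα hstar _ _ _) (rank_triple_lt hα hstar _ _ _) _ ha⟩

theorem eventually_kString_eq {l : ℕ} (hl : P.fullLabel x [l] = some false) :
    ∀ᶠ j in atTop, P.IsTrueStage P.star x j → P.kString (P.initSeg x j) l = P.kPoint x l := by
  have hchild : ∀ᶠ j in atTop, ∀ k ∈ Set.Iio (P.kPoint x l), P.IsTrueStage P.star x j →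
      ∃ a, P.approx (P.initSeg x j) [l, k, a] = some true := by
    refine (eventually_all_finite (Set.finite_Iio _)).2 fun k hk => ?_
    obtain ⟨a, ha⟩ := (P.fullLabel_eq_false_iff x hstar (pair_mem_level hα l k)).1
      (fullLabel_of_lt_kPoint hα hk)
    filter_upwards [(P.goodStages (pos_of_eq_star hα) x P.star (star_lt hα).le).eventually_eq _
      (inTree_triple hα hstar l k a) (rank_triple_lt hα hstar l k a)] with j hlim hj
    exact ⟨a, (hlim hj).trans ha⟩
  filter_upwards [hchild] with j hj htrue
  exact kString_eq (not_exists_approx_kPoint hα hstar htrue hl) fun k hk => hj k hk htrue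

end Convergence

/-- The longest `s` with `s ≺_{α*} t`, for nonempty `t`. -/
noncomputable def starPred (P : Presentation α) (t : List Bool) : List Bool :=
  t.take (P.predLength t)

theorem subBelow_starPred (t : List Bool) :
    P.SubBelow P.star (P.approx (P.starPred t)) (P.approx t) := by
  rcases eq_or_ne t [] with rfl | ht
  · exact fun _ _ _ _ hb => by simpa [starPred] using hb
  have h0 : 0 ∈ P.stages P.star t := P.mem_stages.2 ⟨List.length_pos_iff.2 ht, fun σ _ _ b hb => by
    simp [approx_nil] at hb⟩
  obtain ⟨i, hi, heq⟩ := Finset.exists_mem_eq_sup _ ⟨0, h0⟩ id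
  have hpred : P.predLength t = i := heq
  rw [starPred, hpred]
  exact (P.mem_stages.1 hi).2

section NString

variable {t : List Bool}

theorem nString_nil : P.nString [] = 0 := by
  rw [nString, dif_pos rfl]

open Classical in
theorem nString_of_ne_nil (ht : t ≠ []) : P.nString t =
    if ∃ m < P.nString (P.starPred t), ∃ a,
      P.approx t [m, P.kString (P.starPred t) m, a] = some true
    then sInf {m | m < P.nString (P.starPred t) ∧ ∃ a,
      P.approx t [m, P.kString (P.starPred t) m, a] = some true}
    else P.nString (P.starPred t) + 1 := by
  rw [nString, dif_neg ht]
  rfl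

theorem nString_le_add_one (t : List Bool) : P.nString t ≤ P.nString (P.starPred t) + 1 := by
  rcases eq_or_ne t [] with rfl | ht
  · simp [nString_nil]
  rw [nString_of_ne_nil ht]
  split_ifs with h
  · exact (Nat.sInf_mem h).1.le.trans (Nat.le_succ _)
  · exact le_rfl

theorem not_exists_of_lt_nString (ht : t ≠ []) {m : ℕ} (hm : m < P.nString t)
    (hm' : m < P.nString (P.starPred t)) :
    ¬ ∃ a, P.approx t [m, P.kString (P.starPred t) m, a] = some true := by
  intro ha
  rw [nString_of_ne_nil ht, if_pos ⟨m, hm', ha⟩] at hm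
  exact Nat.notMem_of_lt_sInf hm ⟨hm', ha⟩

theorem le_nString (ht : t ≠ []) {n : ℕ} (hn : n ≤ P.nString (P.starPred t) + 1)
    (h : ∀ m < n, ¬ ∃ a, P.approx t [m, P.kString (P.starPred t) m, a] = some true) :
    n ≤ P.nString t := by
  rw [nString_of_ne_nil ht]
  split_ifs with hex
  · exact not_lt.1 fun hlt => h _ hlt (Nat.sInf_mem hex).2
  · exact hn

theorem kString_starPred (hα : α = P.star + 1 + 1) (hstar : P.star ≠ 0) (ht : t ≠ []) {m : ℕ}
    (hm : m < P.nString t) (hm' : m < P.nString (P.starPred t)) :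
    P.kString t m = P.kString (P.starPred t) m := by
  refine kString_eq (not_exists_of_lt_nString ht hm hm') fun i hi => ?_
  obtain ⟨a, ha⟩ := not_not.1 (Nat.notMem_of_lt_sInf hi)
  exact ⟨a, subBelow_starPred t _ (inTree_triple hα hstar _ _ _) (rank_triple_lt hα hstar _ _ _)
    _ ha⟩

end NString

theorem sqExt_nil (x : P.Leaf → Bool) : P.SqExt 0 [] x :=
  ⟨fun σ _ _ b hb => by simp [approx_nil] at hb, Nat.zero_le _, by simp, by simp⟩

section SqExt

variable {x x' : P.Leaf → Bool} {m : ℕ}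

theorem SqExt.ne_nil {t : List Bool} (h : P.SqExt (m + 1) t x) : t ≠ [] := by
  rintro rfl
  simpa [nString_nil] using h.2.1

section TwoStep

variable (hα : α = P.star + 1 + 1) (hstar : P.star ≠ 0)
include hα hstar

theorem SqExt.starPred {t : List Bool} (h : P.SqExt (m + 1) t x) :
    P.SqExt m (P.starPred t) x := by
  have ht := h.ne_nil
  obtain ⟨hx, hm, hn, hk⟩ := h
  have hle : m ≤ P.nString (P.starPred t) :=
    Nat.le_of_succ_le_succ (hm.trans (nString_le_add_one t))
  refine ⟨(subBelow_starPred t).trans hx, hle,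
    le_trans (Nat.cast_le.2 (Nat.le_succ m)) hn, fun l hl => ?_⟩
  rw [← hk l (by omega), kString_starPred hα hstar ht (by omega) (by omega)]

theorem frequently_le_nString {n : ℕ} (hn : (n : ℕ∞) ≤ P.nPoint x) :
    ∃ᶠ j in atTop, P.IsTrueStage P.star x j ∧ n ≤ P.nString (P.initSeg x j) := by
  have H := P.goodStages (pos_of_eq_star hα) x P.star (star_lt hα).le
  induction n with
  | zero => simpa using H.frequently
  | succ n ih =>
    have hlabel := le_nPoint_iff.1 hn
    have hk : ∀ᶠ j in atTop, ∀ l ∈ Set.Iio (n + 1), P.IsTrueStage P.star x j →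
        P.kString (P.initSeg x j) l = P.kPoint x l :=
      (eventually_all_finite (Set.finite_Iio _)).2 fun l hl =>
        eventually_kString_eq hα hstar (hlabel l hl)
    refine frequently_atTop.2 fun N => ?_
    obtain ⟨i, ⟨hi, hni⟩, hki, hNi⟩ :=
      ((ih (le_trans (Nat.cast_le.2 (Nat.le_succ n)) hn)).and_eventually
        (hk.and (eventually_ge_atTop N))).exists
    obtain ⟨j, hij, hj, hlast⟩ := H.exists_lastStage_eq hi
    have hpred : P.starPred (P.initSeg x j) = P.initSeg x i := by
      rw [← P.take_initSeg x hij.le, ← hlast]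
      rfl
    have hne : P.initSeg x j ≠ [] := List.length_pos_iff.1 (by rw [length_initSeg]; omega)
    refine ⟨j, hNi.trans hij.le, hj, le_nString hne (by rw [hpred]; omega) fun l hl => ?_⟩
    rw [hpred, hki l hl hi]
    exact not_exists_approx_kPoint hα hstar hj (hlabel l hl)

theorem exists_sqExt (hm : (m : ℕ∞) ≤ P.nPoint x) : ∃ s, P.SqExt m s x := by
  have hk : ∀ᶠ j in atTop, ∀ l ∈ Set.Iio m, P.IsTrueStage P.star x j →
      P.kString (P.initSeg x j) l = P.kPoint x l :=
    (eventually_all_finite (Set.finite_Iio _)).2 fun l hl =>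
      eventually_kString_eq hα hstar (le_nPoint_iff.1 hm l hl)
  obtain ⟨j, ⟨hj, hn⟩, hkj⟩ := ((frequently_le_nString hα hstar hm).and_eventually hk).exists
  exact ⟨_, hj, hn, hm, fun l hl => hkj l hl hj⟩

theorem exists_length_eq_codeLoc (hm : (m : ℕ∞) ≤ P.nPoint x) :
    ∃ s : List Bool, s.length = P.codeLoc x m ∧ P.SqExt m s x := by
  obtain ⟨s, hs⟩ := exists_sqExt hα hstar hm
  exact Nat.sInf_mem (s := {l | ∃ s : List Bool, s.length = l ∧ P.SqExt m s x}) ⟨_, s, rfl, hs⟩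

end TwoStep

theorem codeLoc_le {s : List Bool} (h : P.SqExt m s x) : P.codeLoc x m ≤ s.length :=
  Nat.sInf_le ⟨s, rfl, h⟩

theorem codeLoc_zero (x : P.Leaf → Bool) : P.codeLoc x 0 = 0 :=
  Nat.le_zero.1 (codeLoc_le (sqExt_nil x))

/-- The nodes of rank below `α*` that are labelled by some string of length at most `n`. -/
def lowSupport (P : Presentation α) (n : ℕ) : Set (List ℕ) :=
  {σ | P.InTree σ ∧ P.rank σ < P.star ∧ ∃ s : List Bool, s.length ≤ n ∧ P.approx s σ ≠ none}

theorem finite_lowSupport (hα : α = P.star + 1 + 1) (n : ℕ) :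
    (P.lowSupport n).Finite := by
  refine ((List.finite_length_le Bool n).biUnion fun s _ => P.finite_support s).subset ?_
  rintro σ ⟨hσ, hr, s, hs, hd⟩
  exact Set.mem_biUnion (x := s) hs ⟨hσ, hr.trans (star_lt hα), hd⟩

section TwoStep

variable (hα : α = P.star + 1 + 1) (hstar : P.star ≠ 0)
include hα hstar

theorem codeLoc_lt_codeLoc_succ (hm : ((m + 1 : ℕ) : ℕ∞) ≤ P.nPoint x) :
    P.codeLoc x m < P.codeLoc x (m + 1) := by
  obtain ⟨t, ht, hsq⟩ := exists_length_eq_codeLoc hα hstar hm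
  have hle := codeLoc_le (hsq.starPred hα hstar)
  have hlt := P.predLength_lt hsq.ne_nil
  rw [Presentation.starPred, List.length_take] at hle
  omega

theorem codeLoc_le_codeLoc (hm : (m : ℕ∞) ≤ P.nPoint x) (hm' : (m : ℕ∞) ≤ P.nPoint x')
    (hk : ∀ l < m, P.kPoint x' l = P.kPoint x l)
    (hlow : ∀ σ ∈ P.lowSupport (P.codeLoc x m), P.fullLabel x' σ = P.fullLabel x σ) :
    P.codeLoc x' m ≤ P.codeLoc x m := by
  obtain ⟨s, hs, hsub, hn, -, hks⟩ := exists_length_eq_codeLoc hα hstar hm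
  rw [← hs]
  refine codeLoc_le ⟨fun σ hσ hr b hb => ?_, hn, hm', fun l hl => (hks l hl).trans (hk l hl).symm⟩
  rw [hlow σ ⟨hσ, hr, s, hs.le, by simp [hb]⟩]
  exact hsub σ hσ hr b hb

theorem codeLoc_eq_codeLoc (hm : (m : ℕ∞) ≤ P.nPoint x) (hm' : (m : ℕ∞) ≤ P.nPoint x')
    (hk : ∀ l < m, P.kPoint x' l = P.kPoint x l)
    (hlow : ∀ σ ∈ P.lowSupport (P.codeLoc x m), P.fullLabel x' σ = P.fullLabel x σ) :
    P.codeLoc x' m = P.codeLoc x m := by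
  have hle := codeLoc_le_codeLoc hα hstar hm hm' hk hlow
  refine hle.antisymm (codeLoc_le_codeLoc hα hstar hm' hm (fun l hl => (hk l hl).symm) ?_)
  rintro σ ⟨hσ, hr, s, hs, hd⟩
  exact (hlow σ ⟨hσ, hr, s, hs.trans hle, hd⟩).symm

end TwoStep

end SqExt

end Presentation

/-! ### Borel codes -/

/-- Borel codes: `basic A` codes the set `A`, meant to be open, and `node f` codes the union of the
complements of the sets coded by the `f n`. -/
inductive BorelCode (X : Type*)
  | basic (A : Set X)
  | node (f : ℕ → BorelCode X)

namespace BorelCode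

variable {X : Type*}

/-- The set coded by a Borel code. -/
def interp : BorelCode X → Set X
  | basic A => A
  | node f => ⋃ n, (f n).interpᶜ

/-- The code witnesses that the coded set is `Σ⁰_β`. -/
def HasRank [TopologicalSpace X] : BorelCode X → Ordinal.{0} → Prop
  | basic A, β => IsOpen A ∧ 1 ≤ β
  | node f, β => ∀ n, ∃ γ < β, (f n).HasRank γ

/-- The children of `node f` are the `f n`; for totality, `basic A` is its own child. -/
def child : BorelCode X → ℕ → BorelCode X
  | basic A, _ => basic A
  | node f, n => f n

/-- The subcode at the end of a path of children. -/
def sub (c : BorelCode X) (w : List ℕ) : BorelCode X :=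
  w.foldl child c

section HasRank

variable [TopologicalSpace X] {c : BorelCode X} {β γ : Ordinal.{0}}

theorem HasRank.mono (h : c.HasRank β) (hβ : β ≤ γ) : c.HasRank γ := by
  cases c with
  | basic A => exact ⟨h.1, h.2.trans hβ⟩
  | node f => exact fun n => (h n).imp fun _ hδ => ⟨hδ.1.trans_le hβ, hδ.2⟩

theorem HasRank.child (h : c.HasRank β) (n : ℕ) : (c.child n).HasRank β := by
  cases c with
  | basic A => exact h
  | node f =>
    obtain ⟨γ, hγ, hf⟩ := h n
    exact hf.mono hγ.le

theorem HasRank.sub (h : c.HasRank β) (w : List ℕ) : (c.sub w).HasRank β := by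
  induction w generalizing c with
  | nil => exact h
  | cons n _ ih => exact ih (h.child n)

theorem HasRank.exists_interp_eq_iUnion [PerfectlyNormalSpace X] (h : c.HasRank (β + 1))
    (hβ : β ≠ 0) :
    ∃ f : ℕ → BorelCode X, (∀ n, (f n).HasRank β) ∧ c.interp = ⋃ n, (f n).interpᶜ := by
  cases c with
  | node f =>
    refine ⟨f, fun n => ?_, rfl⟩
    obtain ⟨γ, hγ, hf⟩ := h n
    exact hf.mono (Order.lt_add_one_iff.1 hγ)
  | basic A =>
    obtain ⟨U, hU, hA⟩ := isGδ_iff_eq_iInter_nat.1 h.1.isClosed_compl.isGδ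
    have hβ' : 1 ≤ β := Order.one_le_iff_pos.2 (pos_iff_ne_zero.2 hβ)
    refine ⟨fun n => basic (U n), fun n => ⟨hU n, hβ'⟩, ?_⟩
    rw [← compl_compl A, hA, Set.compl_iInter]
    rfl

end HasRank

theorem exists_hasRank_of_isSigma {X : Type} [TopologicalSpace X] {Y : Set X} {β : Ordinal.{0}}
    {A : Set Y} (h : IsSigma β A) :
    ∃ c : BorelCode X, c.HasRank β ∧ ∀ z : Y, z ∈ A ↔ z.1 ∈ c.interp := by
  induction h with
  | of_isOpen A hA =>
    obtain ⟨B, hB, rfl⟩ := isOpen_induced_iff.1 hA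
    exact ⟨basic B, ⟨hB, le_rfl⟩, fun z => Iff.rfl⟩
  | iUnion β _ A γ _ hlt _ ih =>
    choose c hc hcA using ih
    refine ⟨node c, fun n => ⟨γ n, hlt n, hc n⟩, fun z => ?_⟩
    simp only [interp, Set.mem_iUnion, Set.mem_compl_iff, ← hcA, not_not]

theorem exists_iUnion_iInter_of_isSigma {X : Type} [TopologicalSpace X] [PerfectlyNormalSpace X]
    {Y : Set X} {β : Ordinal.{0}} (hβ : β ≠ 0) {A : Set Y} (h : IsSigma (β + 1 + 1) A) :
    ∃ g : ℕ → ℕ → BorelCode X, (∀ k j, (g k j).HasRank β) ∧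
      ∀ z : Y, z ∈ A ↔ ∃ k, ∀ j, z.1 ∈ (g k j).interp := by
  obtain ⟨c, hc, hcA⟩ := exists_hasRank_of_isSigma h
  obtain ⟨f, hf, hcf⟩ := hc.exists_interp_eq_iUnion (Order.succ_ne_bot β)
  choose g hg hfg using fun k => (hf k).exists_interp_eq_iUnion hβ
  refine ⟨g, hg, fun z => ?_⟩
  simp only [hcA, hcf, hfg, Set.compl_iUnion, compl_compl, Set.mem_iUnion, Set.mem_iInter]

end BorelCode

/-! ### Chains and bit strings -/

theorem exists_chain_meeting {S ι : Type*} [Countable ι] (r : S → S → Prop)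
    (hrefl : ∀ s, r s s) (htrans : ∀ s t u, r s t → r t u → r s u) (D : ι → S → Prop)
    (hD : ∀ i s, ∃ t, r s t ∧ D i t) (s₀ : S) :
    ∃ f : ℕ → S, f 0 = s₀ ∧ (∀ i j, i ≤ j → r (f i) (f j)) ∧ ∀ i, ∃ n, D i (f n) := by
  let _ : Preorder S := { le := r, le_refl := hrefl, le_trans := htrans }
  let _ := Encodable.ofCountable ι
  let 𝒟 : ι → Order.Cofinal S := fun i =>
    ⟨{t | D i t}, fun s => (hD i s).imp fun _ ht => ⟨ht.2, ht.1⟩⟩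
  exact ⟨Order.sequenceOfCofinals s₀ 𝒟, rfl,
    fun _ _ hij => Order.sequenceOfCofinals.monotone s₀ 𝒟 hij,
    fun i => ⟨_, Order.sequenceOfCofinals.encode_mem s₀ 𝒟 i⟩⟩

theorem finite_setOf_append_cons_mem {ι : Type*} (F : Finset (List ι)) (σ : List ι) :
    {a | ∃ w, σ ++ a :: w ∈ F}.Finite := by
  refine Set.Finite.of_finite_image (f := some)
    ((F.finite_toSet.image fun τ => τ[σ.length]?).subset ?_) (Option.some_injective ι).injOn
  rintro _ ⟨a, ⟨w, hw⟩, rfl⟩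
  exact ⟨_, hw, by simp⟩

theorem getElem?_eq_some_of_prefix {ι : Type*} {q q' : List ι} (h : q <+: q') {j : ℕ} {b : ι}
    (hj : q[j]? = some b) : q'[j]? = some b := by
  obtain ⟨hlt, rfl⟩ := List.getElem?_eq_some_iff.1 hj
  exact List.prefix_iff_getElem?.1 h j hlt

theorem exists_eq_append_of_append_prefix {ι : Type*} {a w q : List ι} (h : a ++ w <+: q) :
    ∃ w', q = a ++ w' ∧ w <+: w' := by
  obtain ⟨v, rfl⟩ := h
  exact ⟨w ++ v, List.append_assoc a w v, List.prefix_append w v⟩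

/-- The bit sequence with initial segments `q i`, for a chain `q` of strings; bits that no `q i`
determines are `false`. -/
noncomputable def limitBits (q : ℕ → List Bool) (j : ℕ) : Bool :=
  open Classical in decide (∃ i, (q i)[j]? = some true)

theorem limitBits_eq {q : ℕ → List Bool} (hq : ∀ i j, i ≤ j → q i <+: q j) {i j : ℕ} {b : Bool}
    (hb : (q i)[j]? = some b) : limitBits q j = b := by
  classical
  cases b with
  | true => exact decide_eq_true ⟨i, hb⟩
  | false =>
    refine decide_eq_false ?_
    rintro ⟨k, hk⟩
    have hfalse := getElem?_eq_some_of_prefix (hq i _ (le_max_left i k)) hb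
    have htrue := getElem?_eq_some_of_prefix (hq k _ (le_max_right i k)) hk
    cases hfalse.symm.trans htrue

theorem limitBits_append_cons_length (a : List Bool) (b : Bool) (q : ℕ → List Bool) :
    limitBits (fun i => a ++ b :: q i) a.length = b := by
  simp [limitBits]

theorem limitBits_append_cons_of_ne {a : List Bool} {j : ℕ} (hj : j ≠ a.length) (b b' : Bool)
    (q : ℕ → List Bool) :
    limitBits (fun i => a ++ b :: q i) j = limitBits (fun i => a ++ b' :: q i) j := by
  have hget : ∀ w, (a ++ b :: w)[j]? = (a ++ b' :: w)[j]? := by grind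
  exact decide_eq_decide.2 (exists_congr fun i => by rw [hget])

open Topology in
instance nhdsNE_neBot_of_bool_sequence (z : ℕ → Bool) : (𝓝[≠] z).NeBot := by
  have hlim : Tendsto (fun n => Function.update z n (!z n)) atTop (𝓝 z) := by
    refine tendsto_pi_nhds.2 fun j => tendsto_nhds_of_eventually_eq ?_
    filter_upwards [eventually_gt_atTop j] with n hn
    exact Function.update_of_ne hn.ne _ _
  have hne : ∀ n, Function.update z n (!z n) ≠ z := fun n h => by simpa using congrFun h n
  exact (tendsto_nhdsWithin_iff.2 ⟨hlim, .of_forall hne⟩).neBot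

theorem exists_notMem_forall_lt_eq {M : ℕ → ℕ → Bool} (hM : DenseRange M) {B : Set ℕ}
    (hB : B.Finite) (z : ℕ → Bool) (n : ℕ) : ∃ K, K ∉ B ∧ ∀ j < n, M K j = z j := by
  have hdense : Dense (Set.range M \ M '' B) := Dense.sdiff_finite hM (hB.image M)
  obtain ⟨_, hcyl, ⟨K, rfl⟩, hK⟩ := hdense.inter_open_nonempty _
    (PiNat.isOpen_cylinder (E := fun _ => Bool) z n) ⟨z, PiNat.self_mem_cylinder z n⟩
  exact ⟨K, fun h => hK ⟨K, h, rfl⟩, hcyl⟩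

namespace Presentation

variable {α : Ordinal.{0}} {P : Presentation α}

/-! ### Forcing conditions -/

/-- The finite approximations to a generic labelling: finite sets of nodes of rank at most `α*`
labelled `1` and `0` respectively. Higher ranks need no labels, as `n^x` and `k^x` depend only on
the labels of rank `α*`. -/
structure Cond (P : Presentation α) where
  ones : Finset (List ℕ)
  zeros : Finset (List ℕ)
  ones_mem : ∀ σ ∈ ones, P.InTree σ ∧ P.rank σ ≤ P.star
  zeros_mem : ∀ σ ∈ zeros, P.InTree σ ∧ P.rank σ ≤ P.star
  disjoint : ∀ σ ∈ ones, σ ∉ zeros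
  indep : ∀ σ ∈ ones, ∀ k, σ ++ [k] ∉ ones

namespace Cond

/-- `p'` extends `p`. -/
def Ext (p p' : P.Cond) : Prop :=
  p.ones ⊆ p'.ones ∧ p.zeros ⊆ p'.zeros

/-- `p'` extends `p` without adding labels `1` at rank `α*`; such an extension does not change
`n^x`. -/
def LowExt (p p' : P.Cond) : Prop :=
  p.Ext p' ∧ ∀ σ ∈ p'.ones, σ ∈ p.ones ∨ P.rank σ < P.star

/-- The condition implies that `σ` has the label `0`: outright, or because the parent of `σ` has the
label `1`. -/
def Zero (p : P.Cond) (σ : List ℕ) : Prop :=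
  σ ∈ p.zeros ∨ ∃ τ ∈ p.ones, ∃ k, σ = τ ++ [k]

/-- `r` has all the information contained in `p` that is relevant for `Π⁰_β` events. Labels `1` on
nodes of rank above `β` matter only through the labels `0` of their children of rank below `β`. -/
structure Refines (β : Ordinal.{0}) (p r : P.Cond) : Prop where
  ones : ∀ σ ∈ p.ones, P.rank σ ≤ β → σ ∈ r.ones
  zeros : ∀ σ ∈ p.zeros, P.rank σ ≤ β → r.Zero σ
  children : ∀ σ ∈ p.ones, ∀ k, P.InTree (σ ++ [k]) → P.rank (σ ++ [k]) < β → r.Zero (σ ++ [k])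

/-- The labels of `T^x` agree with those of `p`. -/
def Sat (p : P.Cond) (x : P.Leaf → Bool) : Prop :=
  (∀ σ ∈ p.ones, P.fullLabel x σ = some true) ∧ ∀ σ ∈ p.zeros, P.fullLabel x σ = some false

/-- The label of `σ` is decided, and a label `0` of a node that is not a leaf is witnessed by a
child with label `1`. -/
def Decides (p : P.Cond) (σ : List ℕ) : Prop :=
  σ ∈ p.ones ∨ (P.rank σ = 0 ∧ σ ∈ p.zeros) ∨ (P.rank σ ≠ 0 ∧ ∃ k, σ ++ [k] ∈ p.ones)

variable {β γ : Ordinal.{0}} {p p' r r' : P.Cond} {σ : List ℕ} {x : P.Leaf → Bool}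

theorem Ext.refl (p : P.Cond) : p.Ext p :=
  ⟨subset_rfl, subset_rfl⟩

theorem Ext.trans (h : p.Ext p') (h' : p'.Ext r) : p.Ext r :=
  ⟨h.1.trans h'.1, h.2.trans h'.2⟩

theorem LowExt.refl (p : P.Cond) : p.LowExt p :=
  ⟨.refl p, fun _ => Or.inl⟩

theorem LowExt.trans (h : p.LowExt p') (h' : p'.LowExt r) : p.LowExt r :=
  ⟨h.1.trans h'.1, fun σ hσ => (h'.2 σ hσ).elim (h.2 σ) Or.inr⟩

theorem Zero.notMem (h : p.Zero σ) : σ ∉ p.ones := by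
  rintro hσ
  rcases h with h | ⟨τ, hτ, k, rfl⟩
  · exact p.disjoint σ hσ h
  · exact p.indep τ hτ k hσ

theorem Zero.ext (h : p.Zero σ) (hp : p.Ext p') : p'.Zero σ := by
  rcases h with h | ⟨τ, hτ, k, rfl⟩
  · exact Or.inl (hp.2 h)
  · exact Or.inr ⟨τ, hp.1 hτ, k, rfl⟩

theorem Zero.rank_le (h : p.Zero σ) (hσ : P.InTree σ) : P.rank σ ≤ P.star := by
  rcases h with h | ⟨τ, hτ, k, rfl⟩
  · exact (p.zeros_mem σ h).2
  · obtain ⟨hτT, hτr⟩ := p.ones_mem τ hτ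
    exact (P.rank_append_lt hτT (P.inTree_append.1 hσ).2 k).le.trans hτr

theorem Ext.refines (h : p.Ext p') (β : Ordinal.{0}) : Refines β p p' :=
  ⟨fun _ hσ _ => h.1 hσ, fun _ hσ _ => Or.inl (h.2 hσ),
    fun σ hσ k _ _ => Or.inr ⟨σ, h.1 hσ, k, rfl⟩⟩

theorem Refines.ext (h : Refines β p r) (h' : r.Ext r') : Refines β p r' :=
  ⟨fun σ hσ hr => h'.1 (h.ones σ hσ hr), fun σ hσ hr => (h.zeros σ hσ hr).ext h',
    fun σ hσ k hk hr => (h.children σ hσ k hk hr).ext h'⟩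

theorem Sat.of_ext (h : p'.Sat x) (hp : p.Ext p') : p.Sat x :=
  ⟨fun σ hσ => h.1 σ (hp.1 hσ), fun σ hσ => h.2 σ (hp.2 hσ)⟩

/-! ### Constructions of conditions -/

open Classical in
/-- The condition `p` together with the labels `1` of `r` of rank below `β`, and labels `0` on `Z`,
a finite set of nodes of rank at most `β` at which `r` implies this label. -/
noncomputable def amalgam (h : Refines β p r) (Z : Finset (List ℕ))
    (hZ : ∀ σ ∈ Z, P.InTree σ ∧ r.Zero σ ∧ P.rank σ ≤ β) : P.Cond where
  ones := p.ones ∪ r.ones.filter (P.rank · < β)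
  zeros := p.zeros ∪ Z
  ones_mem σ hσ := by
    rcases Finset.mem_union.1 hσ with hp | hr
    · exact p.ones_mem σ hp
    · exact r.ones_mem σ (Finset.mem_filter.1 hr).1
  zeros_mem σ hσ := by
    rcases Finset.mem_union.1 hσ with hp | hz
    · exact p.zeros_mem σ hp
    · exact ⟨(hZ σ hz).1, (hZ σ hz).2.1.rank_le (hZ σ hz).1⟩
  disjoint σ hσ hσ' := by
    simp only [Finset.mem_union, Finset.mem_filter] at hσ hσ'
    rcases hσ with hp | ⟨hr, hlt⟩ <;> rcases hσ' with hpz | hz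
    · exact p.disjoint σ hp hpz
    · exact (hZ σ hz).2.1.notMem (h.ones σ hp (hZ σ hz).2.2)
    · exact (h.zeros σ hpz hlt.le).notMem hr
    · exact (hZ σ hz).2.1.notMem hr
  indep σ hσ k hσk := by
    simp only [Finset.mem_union, Finset.mem_filter] at hσ hσk
    rcases hσ with hp | ⟨hr, hlt⟩ <;> rcases hσk with hpk | ⟨hrk, hltk⟩
    · exact p.indep σ hp k hpk
    · exact (h.children σ hp k (r.ones_mem _ hrk).1 hltk).notMem hrk
    · have hk0 := (P.inTree_append.1 (p.ones_mem _ hpk).1).2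
      have hlt' := (P.rank_append_lt (r.ones_mem σ hr).1 hk0 k).trans hlt
      exact r.indep σ hr k (h.ones _ hpk hlt'.le)
    · exact r.indep σ hr k hrk

theorem exists_finset_children (r : P.Cond) (hγ : γ < β) :
    ∃ C : Finset (List ℕ), ∀ τ, τ ∈ C ↔
      ∃ σ ∈ r.ones, β ≤ P.rank σ ∧ ∃ k, P.rank (σ ++ [k]) < γ ∧ σ ++ [k] = τ := by
  have hfin : (⋃ σ ∈ {σ | σ ∈ r.ones ∧ β ≤ P.rank σ},
      (fun k => σ ++ [k]) '' {k | P.rank (σ ++ [k]) < γ}).Finite := by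
    refine Set.Finite.biUnion (r.ones.finite_toSet.subset fun σ hσ => hσ.1) fun σ hσ => ?_
    exact (P.finite_rank_append_lt (r.ones_mem σ hσ.1).1 (hγ.trans_le hσ.2)).image _
  refine ⟨hfin.toFinset, fun τ => ?_⟩
  simp only [Set.Finite.mem_toFinset, Set.mem_iUnion, Set.mem_image, Set.mem_ofPred_eq,
    exists_prop, and_assoc]

theorem Refines.exists_amalgam (hγ : γ < β) (h : Refines β p r) :
    ∃ u : P.Cond, p.Ext u ∧ (∀ σ ∈ u.ones, σ ∈ p.ones ∨ P.rank σ < β) ∧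
      (∀ σ ∈ r.zeros, P.rank σ ≤ γ → σ ∈ u.zeros) ∧ Refines γ r u := by
  classical
  obtain ⟨C, hC⟩ := r.exists_finset_children hγ
  have hZ : ∀ σ ∈ r.zeros.filter (P.rank · ≤ γ) ∪ C,
      P.InTree σ ∧ r.Zero σ ∧ P.rank σ ≤ β := by
    intro σ hσ
    rcases Finset.mem_union.1 hσ with hz | hc
    · obtain ⟨hz, hle⟩ := Finset.mem_filter.1 hz
      exact ⟨(r.zeros_mem σ hz).1, Or.inl hz, hle.trans hγ.le⟩
    · obtain ⟨τ, hτ, hle, k, hlt, rfl⟩ := (hC σ).1 hc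
      exact ⟨P.inTree_append.2 ⟨(r.ones_mem τ hτ).1, (bot_le.trans_lt (hγ.trans_le hle)).ne'⟩,
        Or.inr ⟨τ, hτ, k, rfl⟩, (hlt.trans hγ).le⟩
  have hones : ∀ σ ∈ r.ones, P.rank σ < β → σ ∈ (amalgam h _ hZ).ones := fun σ hσ hlt =>
    Finset.mem_union_right _ (Finset.mem_filter.2 ⟨hσ, hlt⟩)
  have hzeros : ∀ σ ∈ r.zeros, P.rank σ ≤ γ → σ ∈ (amalgam h _ hZ).zeros := fun σ hσ hle =>
    Finset.mem_union_right _ (Finset.mem_union_left _ (Finset.mem_filter.2 ⟨hσ, hle⟩))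
  refine ⟨amalgam h _ hZ, ⟨Finset.subset_union_left, Finset.subset_union_left⟩, fun σ hσ => ?_,
    hzeros, fun σ hσ hle => hones σ hσ (hle.trans_lt hγ),
    fun σ hσ hle => Or.inl (hzeros σ hσ hle), fun σ hσ k _ hlt => ?_⟩
  · rcases Finset.mem_union.1 hσ with hp | hr
    · exact Or.inl hp
    · exact Or.inr (Finset.mem_filter.1 hr).2
  · rcases lt_or_ge (P.rank σ) β with hσβ | hσβ
    · exact Or.inr ⟨σ, hones σ hσ hσβ, k, rfl⟩
    · exact Or.inl (Finset.mem_union_right _ (Finset.mem_union_right _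
        ((hC _).2 ⟨σ, hσ, hσβ, k, hlt, rfl⟩)))

open Classical in
/-- The condition `p` with the additional label `1` at `σ`. -/
noncomputable def insertOne (p : P.Cond) (σ : List ℕ) (hσ : P.InTree σ ∧ P.rank σ ≤ P.star)
    (hzero : ¬ p.Zero σ) (hchild : ∀ k, σ ++ [k] ∉ p.ones) : P.Cond where
  ones := insert σ p.ones
  zeros := p.zeros
  ones_mem := Finset.forall_mem_insert _ _ _ |>.2 ⟨hσ, p.ones_mem⟩
  zeros_mem := p.zeros_mem
  disjoint := Finset.forall_mem_insert _ _ _ |>.2 ⟨fun h => hzero (Or.inl h), p.disjoint⟩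
  indep τ hτ k hk := by
    rcases Finset.mem_insert.1 hτ with rfl | hτ <;> rcases Finset.mem_insert.1 hk with hk | hk
    · simp at hk
    · exact hchild k hk
    · exact hzero (Or.inr ⟨τ, hτ, k, hk.symm⟩)
    · exact p.indep τ hτ k hk

open Classical in
/-- The condition `p` with additional labels `0` on `Z`. -/
noncomputable def unionZeros (p : P.Cond) (Z : Finset (List ℕ))
    (hZ : ∀ σ ∈ Z, (P.InTree σ ∧ P.rank σ ≤ P.star) ∧ σ ∉ p.ones) : P.Cond where
  ones := p.ones
  zeros := p.zeros ∪ Z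
  ones_mem := p.ones_mem
  zeros_mem σ hσ := (Finset.mem_union.1 hσ).elim (p.zeros_mem σ) fun h => (hZ σ h).1
  disjoint σ hσ hσ' := (Finset.mem_union.1 hσ').elim (p.disjoint σ hσ) fun h => (hZ σ h).2 hσ
  indep := p.indep

open Classical in
/-- The labels of `T^x` on the finite set `F`. -/
noncomputable def ofPoint (x : P.Leaf → Bool) (F : Finset (List ℕ))
    (hF : ∀ σ ∈ F, P.InTree σ ∧ P.rank σ ≤ P.star) : P.Cond where
  ones := F.filter (P.fullLabel x · = some true)
  zeros := F.filter (P.fullLabel x · = some false)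
  ones_mem σ hσ := hF σ (Finset.mem_filter.1 hσ).1
  zeros_mem σ hσ := hF σ (Finset.mem_filter.1 hσ).1
  disjoint σ hσ hσ' := by
    cases (Finset.mem_filter.1 hσ).2.symm.trans (Finset.mem_filter.1 hσ').2
  indep σ hσ k hk := by
    obtain ⟨hσF, hσ⟩ := Finset.mem_filter.1 hσ
    obtain ⟨hkF, hk⟩ := Finset.mem_filter.1 hk
    have h0 := (P.inTree_append.1 (hF _ hkF).1).2
    exact (P.fullLabel_eq_true_iff x h0 ⟨(hF σ hσF).1, rfl⟩).1 hσ ⟨k, hk⟩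

theorem finite_setOf_zero_or_mem (p : P.Cond) (hσ : σ ∉ p.ones) :
    {a | p.Zero (σ ++ [a]) ∨ ∃ k, σ ++ [a] ++ [k] ∈ p.ones}.Finite := by
  classical
  refine (finite_setOf_append_cons_mem (p.ones ∪ p.zeros) σ).subset ?_
  rintro a ((ha | ⟨τ, hτ, k, hk⟩) | ⟨k, ha⟩)
  · exact ⟨[], Finset.mem_union_right _ ha⟩
  · obtain ⟨rfl, -⟩ := List.append_inj' hk rfl
    exact absurd hτ hσ
  · exact ⟨[k], Finset.mem_union_left _ (by simpa using ha)⟩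

theorem exists_lowExt_decides (p : P.Cond) (hσ : P.InTree σ) (hr : P.rank σ ≤ P.star) :
    ∃ p', p.LowExt p' ∧ p'.Decides σ := by
  classical
  by_cases hone : σ ∈ p.ones
  · exact ⟨p, .refl p, Or.inl hone⟩
  by_cases h0 : P.rank σ = 0
  · exact ⟨p.unionZeros {σ} (by simpa using ⟨⟨hσ, hr⟩, hone⟩),
      ⟨⟨subset_rfl, Finset.subset_union_left⟩, fun _ => Or.inl⟩,
      Or.inr (Or.inl ⟨h0, Finset.mem_union_right _ (Finset.mem_singleton_self σ)⟩)⟩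
  · obtain ⟨a, ha⟩ := (p.finite_setOf_zero_or_mem hone).infinite_compl.nonempty
    obtain ⟨hzero, hchild⟩ := not_or.1 ha
    have hlt : P.rank (σ ++ [a]) < P.star := (P.rank_append_lt hσ h0 a).trans_le hr
    exact ⟨p.insertOne (σ ++ [a]) ⟨P.inTree_append.2 ⟨hσ, h0⟩, hlt.le⟩ hzero (not_exists.1 hchild),
      ⟨⟨Finset.subset_insert _ _, subset_rfl⟩,
        (Finset.forall_mem_insert _ _ _).2 ⟨Or.inr hlt, fun _ => Or.inl⟩⟩,
      Or.inr (Or.inr ⟨h0, a, Finset.mem_insert_self _ _⟩)⟩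

theorem Sat.exists_lowExt (hx : p.Sat x) {F : Set (List ℕ)} (hfin : F.Finite)
    (hF : ∀ σ ∈ F, P.InTree σ ∧ P.rank σ < P.star) :
    ∃ p', p.LowExt p' ∧ ∀ x', p'.Sat x' → ∀ σ ∈ F, P.fullLabel x' σ = P.fullLabel x σ := by
  classical
  have hmem : ∀ σ ∈ p.ones ∪ p.zeros ∪ hfin.toFinset, P.InTree σ ∧ P.rank σ ≤ P.star := by
    simp only [Finset.mem_union, Set.Finite.mem_toFinset]
    rintro σ ((hσ | hσ) | hσ)
    · exact p.ones_mem σ hσ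
    · exact p.zeros_mem σ hσ
    · exact ⟨(hF σ hσ).1, (hF σ hσ).2.le⟩
  refine ⟨ofPoint x _ hmem, ⟨⟨fun σ hσ => ?_, fun σ hσ => ?_⟩, fun σ hσ => ?_⟩,
    fun x' hx' σ hσ => ?_⟩
  · exact Finset.mem_filter.2 ⟨by simp [hσ], hx.1 σ hσ⟩
  · exact Finset.mem_filter.2 ⟨by simp [hσ], hx.2 σ hσ⟩
  · obtain ⟨hσF, hσ⟩ := Finset.mem_filter.1 hσ
    simp only [Finset.mem_union, Set.Finite.mem_toFinset] at hσF
    rcases hσF with (hp | hp) | hp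
    · exact Or.inl hp
    · cases (hx.2 σ hp).symm.trans hσ
    · exact Or.inr (hF σ hp).2
  · have hσ' : σ ∈ p.ones ∪ p.zeros ∪ hfin.toFinset := by simp [hσ]
    obtain ⟨_ | _, hb⟩ := P.exists_fullLabel_eq x (hF σ hσ).1
    · rw [hb, hx'.2 σ (Finset.mem_filter.2 ⟨hσ', hb⟩)]
    · rw [hb, hx'.1 σ (Finset.mem_filter.2 ⟨hσ', hb⟩)]

end Cond

/-! ### Chains of conditions -/

/-- The labelling of the leaves given by a chain of conditions; leaves that no condition mentions
have the label `0`. -/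
noncomputable def chainPoint (p : ℕ → P.Cond) (l : P.Leaf) : Bool :=
  open Classical in decide (∃ i, l.1 ∈ (p i).ones)

/-- A chain of conditions and strings determining a point `(chainPoint p, limitBits q)`, including
the labels of all nodes of rank at most `α*`. -/
structure DecidingChain (p : ℕ → P.Cond) (q : ℕ → List Bool) : Prop where
  ext : ∀ i j, i ≤ j → (p i).Ext (p j)
  isPrefix : ∀ i j, i ≤ j → q i <+: q j
  decides : ∀ σ, P.InTree σ → P.rank σ ≤ P.star → ∃ i, (p i).Decides σ
  length : ∀ n, ∃ i, n ≤ (q i).length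

theorem exists_decidingChain {S ι : Type*} [Countable ι] (p : S → P.Cond) (q : S → List Bool)
    (r : S → S → Prop) (hrefl : ∀ s, r s s) (htrans : ∀ s t u, r s t → r t u → r s u)
    (hr : ∀ s t, r s t → (p s).Ext (p t) ∧ q s <+: q t)
    (hlow : ∀ s p' q', (p s).LowExt p' → q s <+: q' → ∃ t, r s t ∧ p t = p' ∧ q t = q')
    (D : ι → S → Prop) (hD : ∀ i s, ∃ t, r s t ∧ D i t) (s₀ : S) :
    ∃ f : ℕ → S, f 0 = s₀ ∧ DecidingChain (fun i => p (f i)) (fun i => q (f i)) ∧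
      ∀ i, ∃ n, D i (f n) := by
  have hdecides : ∀ (σ : {σ // P.InTree σ ∧ P.rank σ ≤ P.star}) (s : S),
      ∃ t, r s t ∧ (p t).Decides σ := by
    rintro ⟨σ, hσ, hle⟩ s
    obtain ⟨p', hp', hdec⟩ := (p s).exists_lowExt_decides hσ hle
    obtain ⟨t, hst, rfl, -⟩ := hlow s p' _ hp' List.prefix_rfl
    exact ⟨t, hst, hdec⟩
  have hlength : ∀ (n : ℕ) (s : S), ∃ t, r s t ∧ n ≤ (q t).length := by
    intro n s
    obtain ⟨t, hst, -, hq⟩ := hlow s _ (q s ++ List.replicate n false) (.refl _)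
      (List.prefix_append _ _)
    exact ⟨t, hst, by simp [hq]⟩
  obtain ⟨f, hf0, hf, hfD⟩ := exists_chain_meeting r hrefl htrans
    (Sum.elim D (Sum.elim (fun (σ : {σ // P.InTree σ ∧ P.rank σ ≤ P.star}) s => (p s).Decides σ)
      fun n s => n ≤ (q s).length))
    (Sum.rec hD (Sum.rec hdecides hlength)) s₀
  exact ⟨f, hf0, ⟨fun i j h => (hr _ _ (hf i j h)).1, fun i j h => (hr _ _ (hf i j h)).2,
    fun σ hσ hle => hfD (.inr (.inl ⟨σ, hσ, hle⟩)), fun n => hfD (.inr (.inr n))⟩,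
    fun i => hfD (.inl i)⟩

theorem exists_lowChain (p₀ : P.Cond) {ι : Type*} [Countable ι]
    (D : ι → P.Cond → List Bool → Prop)
    (hD : ∀ i p q, p₀.LowExt p → ∃ p' q', p.LowExt p' ∧ q <+: q' ∧ D i p' q') :
    ∃ (p : ℕ → P.Cond) (q : ℕ → List Bool), DecidingChain p q ∧ p 0 = p₀ ∧
      (∀ i, p₀.LowExt (p i)) ∧ ∀ i, ∃ n, D i (p n) (q n) := by
  let S := {s : P.Cond × List Bool // p₀.LowExt s.1}
  obtain ⟨f, hf0, hf, hfD⟩ := exists_decidingChain (S := S) (fun s => s.1.1) (fun s => s.1.2)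
    (fun s t => s.1.1.LowExt t.1.1 ∧ s.1.2 <+: t.1.2) (fun s => ⟨.refl _, List.prefix_rfl⟩)
    (fun _ _ _ h h' => ⟨h.1.trans h'.1, h.2.trans h'.2⟩) (fun _ _ h => ⟨h.1.1, h.2⟩)
    (fun s p' q' hp hq => ⟨⟨(p', q'), s.2.trans hp⟩, ⟨hp, hq⟩, rfl, rfl⟩)
    (fun i s => D i s.1.1 s.1.2)
    (fun i s =>
      have ⟨p', q', hp, hq, hDi⟩ := hD i s.1.1 s.1.2 s.2
      ⟨⟨(p', q'), s.2.trans hp⟩, ⟨hp, hq⟩, hDi⟩)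
    ⟨(p₀, []), .refl p₀⟩
  exact ⟨_, _, hf, congrArg (·.1.1) hf0, fun i => (f i).2, hfD⟩

namespace DecidingChain

variable {p : ℕ → P.Cond} {q : ℕ → List Bool}

theorem fullLabel_eq_true_iff (h : DecidingChain p q) {σ : List ℕ} (hσ : P.InTree σ)
    (hle : P.rank σ ≤ P.star) :
    P.fullLabel (chainPoint p) σ = some true ↔ ∃ i, σ ∈ (p i).ones := by
  induction hr : P.rank σ using WellFoundedLT.induction generalizing σ with
  | _ β ih =>
    subst hr
    by_cases h0 : P.rank σ = 0
    · simp [P.fullLabel_leaf _ ⟨σ, hσ, h0⟩, chainPoint]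
    have hchild : ∀ k, P.fullLabel (chainPoint p) (σ ++ [k]) = some true ↔
        ∃ i, σ ++ [k] ∈ (p i).ones := fun k =>
      have hlt := P.rank_append_lt hσ h0 k
      ih _ hlt (P.inTree_append.2 ⟨hσ, h0⟩) (hlt.le.trans hle) rfl
    simp only [P.fullLabel_eq_true_iff _ h0 ⟨hσ, rfl⟩, hchild]
    constructor
    · intro hnone
      obtain ⟨i, hi | hi | ⟨-, k, hk⟩⟩ := h.decides σ hσ hle
      · exact ⟨i, hi⟩
      · exact absurd hi.1 h0
      · exact absurd ⟨k, i, hk⟩ hnone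
    · rintro ⟨i, hi⟩ ⟨k, j, hj⟩
      exact (p (max i j)).indep σ ((h.ext _ _ (le_max_left i j)).1 hi) k
        ((h.ext _ _ (le_max_right i j)).1 hj)

theorem sat (h : DecidingChain p q) (i : ℕ) : (p i).Sat (chainPoint p) := by
  refine ⟨fun σ hσ => ?_, fun σ hσ => ?_⟩
  · obtain ⟨hT, hle⟩ := (p i).ones_mem σ hσ
    exact (h.fullLabel_eq_true_iff hT hle).2 ⟨i, hσ⟩
  · obtain ⟨hT, hle⟩ := (p i).zeros_mem σ hσ
    obtain ⟨_ | _, hb⟩ := P.exists_fullLabel_eq (chainPoint p) hT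
    · exact hb
    · obtain ⟨j, hj⟩ := (h.fullLabel_eq_true_iff hT hle).1 hb
      exact absurd ((h.ext _ _ (le_max_left i j)).2 hσ)
        ((p (max i j)).disjoint σ ((h.ext _ _ (le_max_right i j)).1 hj))

theorem append_cons (h : DecidingChain p q) (a : List Bool) (b : Bool) :
    DecidingChain p fun i => a ++ b :: q i where
  ext := h.ext
  isPrefix i j hij :=
    (List.prefix_append_right_inj a).2 ((List.prefix_cons_inj b).2 (h.isPrefix i j hij))
  decides := h.decides
  length n := (h.length n).imp fun i hi => by
    simp only [List.length_append, List.length_cons]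
    omega

end DecidingChain

theorem Cond.exists_sat (p : P.Cond) : ∃ x, p.Sat x := by
  obtain ⟨_, _, hchain, rfl, -⟩ := exists_lowChain p (ι := Empty) (fun i => i.elim) fun i => i.elim
  exact ⟨_, hchain.sat 0⟩

/-! ### Forcing -/

/-- The points compatible with the condition `p` and the string `q`. -/
def cylinder (p : P.Cond) (q : List Bool) : Set P.Point :=
  {z | (∀ l : P.Leaf, (l.1 ∈ p.ones → z.1 l = true) ∧ (l.1 ∈ p.zeros → z.1 l = false)) ∧
    ∀ j b, q[j]? = some b → z.2 j = b}

/-- The condition `p`, with the string `q`, forces the generic point into the set coded by `c`. -/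
def Forces : BorelCode P.Point → P.Cond → List Bool → Prop
  | .basic A, p, q => cylinder p q ⊆ A
  | .node f, p, q => ∃ n, ∀ p' q', p.Ext p' → q <+: q' → ¬ Forces (f n) p' q'

/-- The condition `p`, with the string `q`, forces the generic point out of the set coded by `c`. -/
def Refutes (c : BorelCode P.Point) (p : P.Cond) (q : List Bool) : Prop :=
  ∀ p' q', p.Ext p' → q <+: q' → ¬ Forces c p' q'

variable {c : BorelCode P.Point}

theorem Forces.mono {p p' : P.Cond} {q q' : List Bool} (h : Forces c p q) (hp : p.Ext p')
    (hq : q <+: q') : Forces c p' q' := by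
  cases c with
  | basic A =>
    refine Set.Subset.trans ?_ h
    rintro z ⟨hleaf, hbit⟩
    exact ⟨fun l => ⟨fun hl => (hleaf l).1 (hp.1 hl), fun hl => (hleaf l).2 (hp.2 hl)⟩,
      fun j b hj => hbit j b (getElem?_eq_some_of_prefix hq hj)⟩
  | node f => exact h.imp fun n hn p'' q'' hp' hq' => hn p'' q'' (hp.trans hp') (hq.trans hq')

theorem Refutes.of_refines {γ : Ordinal.{0}} {p p' : P.Cond} {q : List Bool}
    (hc : ∀ (p r : P.Cond) (q : List Bool), Cond.Refines γ p r → Forces c r q →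
      ∃ u : P.Cond, p.Ext u ∧ Forces c u q)
    (h : Refutes c p q) (hp : Cond.Refines γ p p') : Refutes c p' q := by
  intro r q' hr hq hf
  obtain ⟨u, hu, hu'⟩ := hc p r q' (hp.ext hr) hf
  exact h u q' hu hq hu'

theorem exists_forces_of_refines {β : Ordinal.{0}} (hc : c.HasRank β) {p r : P.Cond}
    {q : List Bool} (hpr : Cond.Refines β p r) (hf : Forces c r q) :
    ∃ u : P.Cond, p.Ext u ∧ Forces c u q ∧ ∀ σ ∈ u.ones, σ ∈ p.ones ∨ P.rank σ < β := by
  induction c generalizing β p r q with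
  | basic A =>
    obtain ⟨u, hpu, hones, hzeros, hru⟩ := hpr.exists_amalgam (zero_lt_one.trans_le hc.2)
    refine ⟨u, hpu, Set.Subset.trans ?_ hf, hones⟩
    rintro z ⟨hleaf, hbit⟩
    exact ⟨fun l => ⟨fun hl => (hleaf l).1 (hru.ones _ hl l.2.2.le),
      fun hl => (hleaf l).2 (hzeros _ hl l.2.2.le)⟩, hbit⟩
  | node f ih =>
    obtain ⟨n, hn⟩ := hf
    obtain ⟨γ, hγ, hrank⟩ := hc n
    obtain ⟨u, hpu, hones, -, hru⟩ := hpr.exists_amalgam hγ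
    refine ⟨u, hpu, ⟨n, Refutes.of_refines (fun p r q h h' => ?_) hn hru⟩, hones⟩
    obtain ⟨v, hpv, hv, -⟩ := ih n hrank h h'
    exact ⟨v, hpv, hv⟩

theorem exists_lowExt_forces (hc : c.HasRank P.star) {p r : P.Cond} {q : List Bool}
    (hr : p.Ext r) (hf : Forces c r q) : ∃ u : P.Cond, p.LowExt u ∧ Forces c u q := by
  obtain ⟨u, hpu, hu, hones⟩ := exists_forces_of_refines hc (hr.refines _) hf
  exact ⟨u, ⟨hpu, hones⟩, hu⟩

theorem exists_lowExt_forces_or_refutes (hc : c.HasRank P.star) (p : P.Cond) (q : List Bool) :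
    ∃ (u : P.Cond) (q' : List Bool), p.LowExt u ∧ q <+: q' ∧ (Forces c u q' ∨ Refutes c u q') := by
  by_cases h : Refutes c p q
  · exact ⟨p, q, .refl p, List.prefix_rfl, Or.inr h⟩
  · simp only [Refutes] at h
    push Not at h
    obtain ⟨r, q', hr, hq, hf⟩ := h
    obtain ⟨u, hu, huf⟩ := exists_lowExt_forces hc hr hf
    exact ⟨u, q', hu, hq, Or.inl huf⟩

namespace DecidingChain

open Filter

variable {p : ℕ → P.Cond} {q : ℕ → List Bool}

theorem mem_cylinder (h : DecidingChain p q) (i : ℕ) :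
    (chainPoint p, limitBits q) ∈ cylinder (p i) (q i) := by
  refine ⟨fun l => ⟨fun hl => ?_, fun hl => ?_⟩, fun j b hb => limitBits_eq h.isPrefix hb⟩
  · exact Option.some_inj.1 ((P.fullLabel_leaf _ l).symm.trans ((h.sat i).1 _ hl))
  · exact Option.some_inj.1 ((P.fullLabel_leaf _ l).symm.trans ((h.sat i).2 _ hl))

theorem eventually_fst_eq (h : DecidingChain p q) (l : P.Leaf) :
    ∀ᶠ i in atTop, ∀ z ∈ cylinder (p i) (q i), z.1 l = chainPoint p l := by
  obtain ⟨i, hi⟩ := h.decides l.1 l.2.1 (by rw [l.2.2]; exact bot_le)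
  filter_upwards [eventually_ge_atTop i] with j hj z hz
  rcases hi with hi | ⟨-, hi⟩ | ⟨h0, -⟩
  · have hl := (h.ext i j hj).1 hi
    exact ((hz.1 l).1 hl).trans (((h.mem_cylinder j).1 l).1 hl).symm
  · have hl := (h.ext i j hj).2 hi
    exact ((hz.1 l).2 hl).trans (((h.mem_cylinder j).1 l).2 hl).symm
  · exact absurd l.2.2 h0

theorem eventually_snd_eq (h : DecidingChain p q) (n : ℕ) :
    ∀ᶠ i in atTop, ∀ z ∈ cylinder (p i) (q i), z.2 n = limitBits q n := by
  obtain ⟨i, hi⟩ := h.length (n + 1)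
  filter_upwards [eventually_ge_atTop i] with j hj z hz
  have hb := List.getElem?_eq_getElem (Nat.lt_of_succ_le (hi.trans (h.isPrefix i j hj).length_le))
  rw [hz.2 n _ hb, limitBits_eq h.isPrefix hb]

theorem exists_cylinder_subset (h : DecidingChain p q) {A : Set P.Point} (hA : IsOpen A)
    (hmem : (chainPoint p, limitBits q) ∈ A) : ∃ i, cylinder (p i) (q i) ⊆ A := by
  obtain ⟨U, V, hU, hV, hxU, hyV, hUV⟩ := isOpen_prod_iff.1 hA _ _ hmem
  obtain ⟨I, u, hu, hIU⟩ := isOpen_pi_iff.1 hU _ hxU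
  obtain ⟨J, v, hv, hJV⟩ := isOpen_pi_iff.1 hV _ hyV
  obtain ⟨i, hI, hJ⟩ := (((eventually_all_finset I).2 fun l _ => h.eventually_fst_eq l).and
    ((eventually_all_finset J).2 fun n _ => h.eventually_snd_eq n)).exists
  refine ⟨i, fun z hz => hUV ⟨hIU fun l hl => ?_, hJV fun n hn => ?_⟩⟩
  · rw [hI l hl z hz]
    exact (hu l hl).2
  · rw [hJ n hn z hz]
    exact (hv n hn).2

theorem mem_interp_iff (h : DecidingChain p q) {β : Ordinal.{0}} (hc : c.HasRank β)
    (hdec : ∀ w, ∃ i, Forces (c.sub w) (p i) (q i) ∨ Refutes (c.sub w) (p i) (q i)) :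
    (chainPoint p, limitBits q) ∈ c.interp ↔ ∃ i, Forces c (p i) (q i) := by
  induction c generalizing β with
  | basic A => exact ⟨h.exists_cylinder_subset hc.1, fun ⟨i, hi⟩ => hi (h.mem_cylinder i)⟩
  | node f ih =>
    have hchild : ∀ n, (chainPoint p, limitBits q) ∈ (f n).interp ↔ ∃ i, Forces (f n) (p i) (q i) :=
      fun n => have ⟨_, _, hfn⟩ := hc n; ih n hfn fun w => hdec (n :: w)
    simp only [BorelCode.interp, Set.mem_iUnion, Set.mem_compl_iff, hchild]
    constructor
    · rintro ⟨n, hn⟩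
      obtain ⟨i, hi | hi⟩ := hdec [n]
      · exact absurd ⟨i, hi⟩ hn
      · exact ⟨i, n, hi⟩
    · rintro ⟨i, n, hn⟩
      refine ⟨n, fun ⟨j, hj⟩ => hn _ _ (h.ext i _ (le_max_left i j))
        (h.isPrefix i _ (le_max_left i j))
        (hj.mono (h.ext j _ (le_max_right i j)) (h.isPrefix j _ (le_max_right i j)))⟩

end DecidingChain

/-! ### Codes and coding locations determined by a condition -/

namespace Cond

/-- The condition `p` implies that `m ≤ n^x` and that `k^x(l) = κ l` for all `l < m`, and all its
labels `1` of rank `α*` are for this purpose. -/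
structure Codes (p : P.Cond) (m : ℕ) (κ : ℕ → ℕ) : Prop where
  one_mem : ∀ l < m, [l, κ l] ∈ p.ones
  zero_mem : ∀ l < m, ∀ k < κ l, [l, k] ∈ p.zeros
  eq_of_rank : ∀ σ ∈ p.ones, P.rank σ = P.star → ∃ l < m, σ = [l, κ l]

namespace Codes

variable {p p' : P.Cond} {m : ℕ} {κ : ℕ → ℕ} {x : P.Leaf → Bool}

theorem of_lowExt (h : p.Codes m κ) (hp : p.LowExt p') : p'.Codes m κ where
  one_mem l hl := hp.1.1 (h.one_mem l hl)
  zero_mem l hl k hk := hp.1.2 (h.zero_mem l hl k hk)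
  eq_of_rank σ hσ hr := (hp.2 σ hσ).elim (h.eq_of_rank σ · hr) fun hlt => absurd hr hlt.ne

theorem kPoint_eq (h : p.Codes m κ) (hx : p.Sat x) {l : ℕ} (hl : l < m) : P.kPoint x l = κ l :=
  Presentation.kPoint_eq (hx.1 _ (h.one_mem l hl)) fun k hk => hx.2 _ (h.zero_mem l hl k hk)

theorem fullLabel_singleton (h : p.Codes m κ) (hα : α = P.star + 1 + 1) (hx : p.Sat x) {l : ℕ}
    (hl : l < m) : P.fullLabel x [l] = some false :=
  (fullLabel_singleton_eq_false_iff hα).2 ⟨κ l, hx.1 _ (h.one_mem l hl)⟩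

theorem le_nPoint (h : p.Codes m κ) (hα : α = P.star + 1 + 1) (hx : p.Sat x) :
    (m : ℕ∞) ≤ P.nPoint x :=
  le_nPoint_iff.2 fun _ => h.fullLabel_singleton hα hx

theorem nPoint_chainPoint (h : p.Codes m κ) (hα : α = P.star + 1 + 1) {r : ℕ → P.Cond}
    {q : ℕ → List Bool} (hr : DecidingChain r q) (hlow : ∀ i, p.LowExt (r i)) :
    P.nPoint (chainPoint r) = m := by
  refine nPoint_eq (fun l => h.fullLabel_singleton hα ((hr.sat 0).of_ext (hlow 0).1)) ?_
  have hm : [m] ∈ P.level (P.star + 1) := singleton_mem_level hα m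
  rw [P.fullLabel_eq_true_iff _ (Order.succ_ne_bot _) hm]
  rintro ⟨k, hk⟩
  obtain ⟨hT, hrank⟩ := pair_mem_level hα m k
  obtain ⟨i, hi⟩ := (hr.fullLabel_eq_true_iff hT hrank.le).1 hk
  obtain ⟨l, hl, hlk⟩ := (h.of_lowExt (hlow i)).eq_of_rank _ hi hrank
  exact hl.ne' (List.cons.inj hlk).1

theorem exists_succ (h : p.Codes m κ) (hα : α = P.star + 1 + 1) {K : ℕ} (hzero : ¬ p.Zero [m, K])
    (hchild : ∀ k, [m, K, k] ∉ p.ones) :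
    ∃ p', p.Ext p' ∧ p'.Codes (m + 1) (Function.update κ m K) := by
  have hlevel := pair_mem_level hα m
  have hnotMem : ∀ k, [m, k] ∉ p.ones := fun k hk =>
    have ⟨_, hl, hlk⟩ := h.eq_of_rank _ hk (hlevel k).2
    hl.ne' (List.cons.inj hlk).1
  let p₁ := p.insertOne [m, K] ⟨(hlevel K).1, (hlevel K).2.le⟩ hzero hchild
  have hZ : ∀ σ ∈ (Finset.range K).image fun k => [m, k],
      (P.InTree σ ∧ P.rank σ ≤ P.star) ∧ σ ∉ p₁.ones := by
    simp only [Finset.forall_mem_image, Finset.mem_range]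
    refine fun k hk => ⟨⟨(hlevel k).1, (hlevel k).2.le⟩, fun hmem => ?_⟩
    rcases Finset.mem_insert.1 hmem with heq | hmem
    · simp only [List.cons.injEq, true_and, and_true] at heq
      exact hk.ne heq
    · exact hnotMem k hmem
  have hκ : ∀ l < m, Function.update κ m K l = κ l := fun l hl => Function.update_of_ne hl.ne _ _
  refine ⟨p₁.unionZeros _ hZ, ⟨Finset.subset_insert _ _, Finset.subset_union_left⟩,
    Nat.forall_lt_succ_right.2 ⟨fun l hl => ?_, ?_⟩,
    Nat.forall_lt_succ_right.2 ⟨fun l hl k hk => ?_, fun k hk => ?_⟩, fun σ hσ hr => ?_⟩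
  · exact Finset.mem_insert_of_mem (by rw [hκ l hl]; exact h.one_mem l hl)
  · rw [Function.update_self]
    exact Finset.mem_insert_self _ _
  · rw [hκ l hl] at hk
    exact Finset.mem_union_left _ (h.zero_mem l hl k hk)
  · rw [Function.update_self] at hk
    exact Finset.mem_union_right _ (Finset.mem_image_of_mem _ (Finset.mem_range.2 hk))
  · rcases Finset.mem_insert.1 hσ with rfl | hσ
    · exact ⟨m, Nat.lt_succ_self m, by rw [Function.update_self]⟩
    · obtain ⟨l, hl, rfl⟩ := h.eq_of_rank σ hσ hr
      exact ⟨l, hl.trans (Nat.lt_succ_self m), by rw [hκ l hl]⟩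

theorem finite_setOf_not_exists_succ (h : p.Codes m κ) (hα : α = P.star + 1 + 1) :
    {K | ¬ ∃ p', p.Ext p' ∧ p'.Codes (m + 1) (Function.update κ m K)}.Finite := by
  have hm : [m] ∉ p.ones := fun hmem =>
    absurd (p.ones_mem _ hmem).2 (by
      rw [(singleton_mem_level hα m).2]
      exact (Order.lt_succ P.star).not_ge)
  refine (p.finite_setOf_zero_or_mem hm).subset fun K hK => ?_
  by_contra hfresh
  obtain ⟨hzero, hchild⟩ := not_or.1 hfresh
  exact hK (h.exists_succ hα hzero (not_exists.1 hchild))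

theorem exists_lowExt_codeLoc (h : p.Codes m κ) (hα : α = P.star + 1 + 1) (hstar : P.star ≠ 0) :
    ∃ p' n, p.LowExt p' ∧ ∀ x, p'.Sat x → P.codeLoc x m = n := by
  obtain ⟨x, hx⟩ := p.exists_sat
  obtain ⟨p', hp', hlabel⟩ := hx.exists_lowExt (finite_lowSupport hα (P.codeLoc x m))
    fun σ hσ => ⟨hσ.1, hσ.2.1⟩
  refine ⟨p', P.codeLoc x m, hp', fun x' hx' => ?_⟩
  have hx'p := hx'.of_ext hp'.1
  exact codeLoc_eq_codeLoc hα hstar (h.le_nPoint hα hx) (h.le_nPoint hα hx'p)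
    (fun l hl => (h.kPoint_eq hx'p hl).trans (h.kPoint_eq hx hl).symm) (hlabel x' hx')

end Codes

end Cond

/-! ### Conditions for the generic vertex -/

/-- A forcing condition for vertices `(x, y)` of the graph: `p` approximates `x` and determines
`k^x(l) = κ l` for `l < m` and `c^x(l) = c l` for `l ≤ m`, and `q` is an initial segment of `y` that
is long enough for the codes `κ l` to be correct. -/
structure State (P : Presentation α) (M : ℕ → ℕ → Bool) where
  p : P.Cond
  q : List Bool
  m : ℕ
  κ : ℕ → ℕ
  c : ℕ → ℕ
  codes : p.Codes m κ
  loc : ∀ x, p.Sat x → ∀ l ≤ m, P.codeLoc x l = c l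
  coded : ∀ l < m, ∀ j ≤ c l, q[j]? = some (M (κ l) j)

namespace State

variable {M : ℕ → ℕ → Bool}

/-- The state `t` extends `s`. -/
def Ext (s t : P.State M) : Prop :=
  s.p.Ext t.p ∧ s.q <+: t.q

theorem Ext.refl (s : P.State M) : s.Ext s :=
  ⟨.refl _, List.prefix_rfl⟩

theorem Ext.trans {s t u : P.State M} (h : s.Ext t) (h' : t.Ext u) : s.Ext u :=
  ⟨h.1.trans h'.1, h.2.trans h'.2⟩

/-- The extension of a state by a low extension of its condition and any extension of its string. -/
def lowExt (s : P.State M) {p' : P.Cond} {q' : List Bool} (hp : s.p.LowExt p') (hq : s.q <+: q') :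
    P.State M where
  p := p'
  q := q'
  m := s.m
  κ := s.κ
  c := s.c
  codes := s.codes.of_lowExt hp
  loc x hx := s.loc x (hx.of_ext hp.1)
  coded l hl j hj := getElem?_eq_some_of_prefix hq (s.coded l hl j hj)

instance : Nonempty (P.State M) :=
  ⟨{ p := ⟨∅, ∅, by simp, by simp, by simp, by simp⟩
     q := []
     m := 0
     κ := id
     c := 0
     codes := ⟨by simp, by simp, by simp⟩
     loc := fun x _ l hl => by rw [Nat.le_zero.1 hl]; exact P.codeLoc_zero x
     coded := by simp }⟩

theorem exists_succ (hα : α = P.star + 1 + 1) (hstar : P.star ≠ 0) (hM : DenseRange M)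
    (s : P.State M) (hlen : s.c s.m < s.q.length) :
    ∃ t : P.State M, s.Ext t ∧ t.m = s.m + 1 ∧ t.q = s.q ∧ s.c s.m < t.c t.m := by
  obtain ⟨K, hK, hcode⟩ := exists_notMem_forall_lt_eq hM (s.codes.finite_setOf_not_exists_succ hα)
    (fun j => s.q.getD j false) (s.c s.m + 1)
  obtain ⟨p₁, hp₁, hcodes₁⟩ := not_not.1 hK
  obtain ⟨p₂, n, hp₂, hloc⟩ := hcodes₁.exists_lowExt_codeLoc hα hstar
  have hcodes₂ := hcodes₁.of_lowExt hp₂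
  have hext : s.p.Ext p₂ := hp₁.trans hp₂.1
  have hlt : s.c s.m < n := by
    obtain ⟨x, hx⟩ := p₂.exists_sat
    rw [← hloc x hx, ← s.loc x (hx.of_ext hext) s.m le_rfl]
    exact codeLoc_lt_codeLoc_succ hα hstar (hcodes₂.le_nPoint hα hx)
  have hc : ∀ l ≤ s.m, Function.update s.c (s.m + 1) n l = s.c l := fun l hl =>
    Function.update_of_ne (Nat.lt_succ_of_le hl).ne _ _
  refine ⟨⟨p₂, s.q, s.m + 1, _, Function.update s.c (s.m + 1) n, hcodes₂, fun x hx l hl => ?_,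
    Nat.forall_lt_succ_right.2 ⟨fun l hl j hj => ?_, fun j hj => ?_⟩⟩, ⟨hext, List.prefix_rfl⟩,
    rfl, rfl, by simpa only [Function.update_self] using hlt⟩
  · rcases Nat.le_succ_iff.1 hl with hl | rfl
    · rw [hc l hl, s.loc x (hx.of_ext hext) l hl]
    · rw [Function.update_self, hloc x hx]
  · rw [hc l hl.le] at hj
    rw [Function.update_of_ne hl.ne, s.coded l hl j hj]
  · rw [hc s.m le_rfl] at hj
    rw [Function.update_self, hcode j (Nat.lt_succ_of_le hj)]
    simp [hj.trans_lt hlen]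

theorem exists_ext_length_le (hα : α = P.star + 1 + 1) (hstar : P.star ≠ 0) (hM : DenseRange M)
    (s : P.State M) : ∃ t : P.State M, s.Ext t ∧ t.q.length ≤ t.c t.m := by
  induction hn : s.q.length - s.c s.m using Nat.strong_induction_on generalizing s with
  | _ n ih =>
    by_cases hle : s.q.length ≤ s.c s.m
    · exact ⟨s, .refl s, hle⟩
    obtain ⟨t, hst, -, hq, hlt⟩ := s.exists_succ hα hstar hM (not_le.1 hle)
    obtain ⟨u, htu, hu⟩ := ih (t.q.length - t.c t.m) (by rw [hq]; omega) t rfl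
    exact ⟨u, hst.trans htu, hu⟩

theorem exists_ext_lt (hα : α = P.star + 1 + 1) (hstar : P.star ≠ 0) (hM : DenseRange M)
    (n : ℕ) (s : P.State M) : ∃ t : P.State M, s.Ext t ∧ n < t.m := by
  have hstep : ∀ s : P.State M, ∃ t : P.State M, s.Ext t ∧ s.m < t.m := fun s => by
    let s' := s.lowExt (.refl s.p) (List.prefix_append s.q (List.replicate (s.c s.m + 1) false))
    obtain ⟨t, hst, hm, -⟩ := s'.exists_succ hα hstar hM (by simp [s', lowExt]; omega)
    exact ⟨t, ⟨hst.1, (List.prefix_append _ _).trans hst.2⟩, (Nat.lt_succ_self _).trans_eq hm.symm⟩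
  induction n with
  | zero => exact (hstep s).imp fun t ht => ⟨ht.1, (Nat.zero_le _).trans_lt ht.2⟩
  | succ n ih =>
    obtain ⟨t, hst, hnt⟩ := ih
    obtain ⟨u, htu, hlt⟩ := hstep t
    exact ⟨u, hst.trans htu, (Nat.succ_le_of_lt hnt).trans_lt hlt⟩

theorem eq_code (s : P.State M) {x : P.Leaf → Bool} (hx : s.p.Sat x) {y : ℕ → Bool}
    (hy : ∀ j b, s.q[j]? = some b → y j = b) {l : ℕ} (hl : l < s.m) {j : ℕ}
    (hj : j < P.codeLoc x l + 1) : y j = M (P.kPoint x l) j := by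
  rw [s.loc x hx l hl.le] at hj
  rw [s.codes.kPoint_eq hx hl]
  exact hy j _ (s.coded l hl j (Nat.le_of_lt_succ hj))

/-! ### Forcing the generic vertex out of an independent set -/

theorem exists_splitting_chain (s : P.State M) {a : List Bool} (ha : s.q <+: a)
    {O : ℕ → BorelCode P.Point} (hO : ∀ j, (O j).HasRank P.star)
    (hnot : ∀ t : P.State M, s.Ext t → ∀ j, ¬ Refutes (O j) t.p t.q) :
    ∃ p w, DecidingChain p w ∧ (∀ i, s.p.LowExt (p i)) ∧
      ∀ b j, (chainPoint p, limitBits fun i => a ++ b :: w i) ∈ (O j).interp := by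
  have hforce : ∀ (i : Bool × ℕ) p w, s.p.LowExt p → ∃ p' w', p.LowExt p' ∧ w <+: w' ∧
      Forces (O i.2) p' (a ++ i.1 :: w') := by
    rintro ⟨b, j⟩ p w hp
    have hq : s.q <+: a ++ b :: w := ha.trans (List.prefix_append _ _)
    have hj := hnot (s.lowExt hp hq) ⟨hp.1, hq⟩ j
    simp only [Refutes] at hj
    push Not at hj
    obtain ⟨r, q', hr, hq', hf⟩ := hj
    obtain ⟨w', rfl, hw⟩ := exists_eq_append_of_append_prefix (a := a ++ [b]) (w := w)
      (by simpa [lowExt] using hq')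
    obtain ⟨u, hu, huf⟩ := exists_lowExt_forces (hO j) hr hf
    exact ⟨u, w', hu, hw, by simpa using huf⟩
  have hdecide : ∀ (i : Bool × ℕ × List ℕ) p w, s.p.LowExt p → ∃ p' w', p.LowExt p' ∧ w <+: w' ∧
      (Forces ((O i.2.1).sub i.2.2) p' (a ++ i.1 :: w') ∨
        Refutes ((O i.2.1).sub i.2.2) p' (a ++ i.1 :: w')) := by
    rintro ⟨b, j, v⟩ p w -
    obtain ⟨u, q', hu, hq', hdec⟩ :=
      exists_lowExt_forces_or_refutes ((hO j).sub v) p (a ++ [b] ++ w)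
    obtain ⟨w', rfl, hw⟩ := exists_eq_append_of_append_prefix hq'
    exact ⟨u, w', hu, hw, by simpa using hdec⟩
  obtain ⟨p, w, hchain, -, hlow, hD⟩ := exists_lowChain s.p
    (Sum.elim (fun (i : Bool × ℕ) p w => Forces (O i.2) p (a ++ i.1 :: w))
      fun (i : Bool × ℕ × List ℕ) p w => Forces ((O i.2.1).sub i.2.2) p (a ++ i.1 :: w) ∨
        Refutes ((O i.2.1).sub i.2.2) p (a ++ i.1 :: w)) (Sum.rec hforce hdecide)
  exact ⟨p, w, hchain, hlow, fun b j => ((hchain.append_cons a b).mem_interp_iff (hO j)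
    fun v => hD (.inr (b, j, v))).2 (hD (.inl (b, j)))⟩

end State

theorem adj_of_forall_ne {M : ℕ → ℕ → Bool} {x : P.Leaf → Bool} {y y' : ℕ → Bool} {n : ℕ}
    (hn : P.nPoint x = n) (hy : (x, y) ∈ P.Y M) (hy' : (x, y') ∈ P.Y M)
    (hne : ∀ j ≠ P.codeLoc x n, y j = y' j) (hfalse : y (P.codeLoc x n) = false)
    (htrue : y' (P.codeLoc x n) = true) : (P.H M).Adj ⟨_, hy⟩ ⟨_, hy'⟩ := by
  refine ⟨rfl, n, hn, Set.ext fun j => ?_, by simp [hfalse]⟩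
  rw [Set.mem_symmDiff, Set.mem_singleton_iff]
  by_cases hj : j = P.codeLoc x n
  · simp [hj, hfalse, htrue]
  · simp [hne j hj, hj]

namespace State

variable {M : ℕ → ℕ → Bool}

theorem exists_ext_refutes (hα : α = P.star + 1 + 1) (hstar : P.star ≠ 0) (hM : DenseRange M)
    {O : ℕ → BorelCode P.Point} (hO : ∀ j, (O j).HasRank P.star)
    (hind : ∀ z z' : P.Y M, (P.H M).Adj z z' →
      ¬ ((∀ j, z.1 ∈ (O j).interp) ∧ ∀ j, z'.1 ∈ (O j).interp)) (s₀ : P.State M) :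
    ∃ t : P.State M, s₀.Ext t ∧ ∃ j, Refutes (O j) t.p t.q := by
  by_contra! hcon
  obtain ⟨s, hs, hlen⟩ := s₀.exists_ext_length_le hα hstar hM
  let a := s.q ++ List.replicate (s.c s.m - s.q.length) false
  have hqa : s.q <+: a := List.prefix_append _ _
  have hlength : a.length = s.c s.m := by simp [a, hlen]
  obtain ⟨p, w, hchain, hlow, hmem⟩ := s.exists_splitting_chain hqa hO
    fun t ht => hcon t (hs.trans ht)
  have hsat : s.p.Sat (chainPoint p) := (hchain.sat 0).of_ext (hlow 0).1
  have hn : P.nPoint (chainPoint p) = s.m := s.codes.nPoint_chainPoint hα hchain hlow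
  have hloc : P.codeLoc (chainPoint p) s.m = a.length :=
    (s.loc _ hsat s.m le_rfl).trans hlength.symm
  have hY : ∀ b, (chainPoint p, limitBits fun i => a ++ b :: w i) ∈ P.Y M := fun b l hl j hj =>
    s.eq_code hsat
      (fun j e he => limitBits_eq (hchain.append_cons a b).isPrefix (i := 0)
        (getElem?_eq_some_of_prefix (hqa.trans (List.prefix_append _ _)) he))
      (Nat.cast_lt.1 (hl.trans_eq hn)) hj
  refine hind _ _ (adj_of_forall_ne hn (hY false) (hY true) (fun j hj => ?_) ?_ ?_)
    ⟨hmem false, hmem true⟩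
  · exact limitBits_append_cons_of_ne (hloc ▸ hj) _ _ _
  · rw [hloc, limitBits_append_cons_length]
  · rw [hloc, limitBits_append_cons_length]

/-! ### The generic vertex -/

theorem exists_generic_chain (hα : α = P.star + 1 + 1) (hstar : P.star ≠ 0) (hM : DenseRange M)
    {ι : Type*} [Countable ι] (D : ι → P.State M → Prop)
    (hD : ∀ i (s : P.State M), ∃ t, s.Ext t ∧ D i t) :
    ∃ f : ℕ → P.State M, DecidingChain (fun i => (f i).p) (fun i => (f i).q) ∧
      (∀ m, ∃ i, m < (f i).m) ∧ ∀ i, ∃ n, D i (f n) := by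
  obtain ⟨f, -, hchain, hfD⟩ := exists_decidingChain (S := P.State M) State.p State.q State.Ext
    Ext.refl (fun _ _ _ => Ext.trans) (fun _ _ h => h)
    (fun s _ _ hp hq => ⟨s.lowExt hp hq, ⟨hp.1, hq⟩, rfl, rfl⟩)
    (Sum.elim D fun m s => m < s.m) (Sum.rec hD (exists_ext_lt hα hstar hM)) (Classical.arbitrary _)
  exact ⟨f, hchain, fun m => hfD (.inr m), fun i => hfD (.inl i)⟩

end State

theorem exists_mem_Y_forall_exists_notMem (hα : α = P.star + 1 + 1) (hstar : P.star ≠ 0)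
    {M : ℕ → ℕ → Bool} (hM : DenseRange M) {ι : Type*} [Countable ι] {O : ι → ℕ → BorelCode P.Point}
    (hO : ∀ n j, (O n j).HasRank P.star)
    (hind : ∀ n, ∀ z z' : P.Y M, (P.H M).Adj z z' →
      ¬ ((∀ j, z.1 ∈ (O n j).interp) ∧ ∀ j, z'.1 ∈ (O n j).interp)) :
    ∃ z ∈ P.Y M, ∀ n, ∃ j, z ∉ (O n j).interp := by
  have hdecide : ∀ (i : ι × ℕ × List ℕ) (s : P.State M), ∃ t, s.Ext t ∧
      (Forces ((O i.1 i.2.1).sub i.2.2) t.p t.q ∨ Refutes ((O i.1 i.2.1).sub i.2.2) t.p t.q) := by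
    rintro ⟨n, j, v⟩ s
    obtain ⟨u, q', hu, hq, h⟩ := exists_lowExt_forces_or_refutes ((hO n j).sub v) s.p s.q
    exact ⟨s.lowExt hu hq, ⟨hu.1, hq⟩, h⟩
  obtain ⟨f, hchain, hm, hD⟩ := State.exists_generic_chain hα hstar hM
    (Sum.elim (fun (i : ι × ℕ × List ℕ) s => Forces ((O i.1 i.2.1).sub i.2.2) s.p s.q ∨
      Refutes ((O i.1 i.2.1).sub i.2.2) s.p s.q) fun n s => ∃ j, Refutes (O n j) s.p s.q)
    (Sum.rec hdecide fun n s => s.exists_ext_refutes hα hstar hM (hO n) (hind n))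
  refine ⟨(chainPoint fun i => (f i).p, limitBits fun i => (f i).q), fun l _ j hj => ?_,
    fun n => ?_⟩
  · obtain ⟨i, hi⟩ := hm l
    exact (f i).eq_code (hchain.sat i) (fun _ _ => limitBits_eq hchain.isPrefix) hi hj
  · obtain ⟨i, j, hij⟩ := hD (.inr n)
    refine ⟨j, fun hmem => ?_⟩
    obtain ⟨k, hk⟩ := (hchain.mem_interp_iff (hO n j) fun v => hD (.inl (n, j, v))).1 hmem
    exact hij _ _ (hchain.ext i _ (le_max_left i k)) (hchain.isPrefix i _ (le_max_left i k))
      (hk.mono (hchain.ext k _ (le_max_right i k)) (hchain.isPrefix k _ (le_max_right i k)))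

end Presentation

end BorelColouring

theorem mainTheorem2 (α : Ordinal.{0}) (hα : 3 ≤ α) (hsucc : ∃ β : Ordinal.{0}, α = β + 1 + 1)
    (P : BorelColouring.Presentation α) (M : ℕ → ℕ → Bool) (hM : DenseRange M) :
    ¬ BorelColouring.HasCountableSigmaColouring α (P.H M) := by
  obtain ⟨β, hβ⟩ := hsucc
  have hs : α = P.star + 1 + 1 := by rw [P.star_eq hβ]; exact hβ
  have hstar : P.star ≠ 0 := fun h => by
    rw [h] at hs
    rw [hs] at hα
    norm_num at hα
  rintro ⟨c, hc, hadj⟩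
  have hpieces : ∀ n, ∃ g : ℕ → ℕ → BorelColouring.BorelCode P.Point,
      (∀ k j, (g k j).HasRank P.star) ∧
        ∀ z : P.Y M, z ∈ c ⁻¹' {n} ↔ ∃ k, ∀ j, z.1 ∈ (g k j).interp := fun n =>
    BorelColouring.BorelCode.exists_iUnion_iInter_of_isSigma hstar (hs ▸ hc n)
  choose g hrank hmem using hpieces
  obtain ⟨z, hz, hout⟩ := P.exists_mem_Y_forall_exists_notMem hs hstar hM
    (O := fun i : ℕ × ℕ => g i.1 i.2) (fun i j => hrank i.1 i.2 j)
    fun i z z' hzz' ⟨hiz, hiz'⟩ => hadj z z' hzz'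
      (((hmem i.1 z).2 ⟨i.2, hiz⟩).trans ((hmem i.1 z').2 ⟨i.2, hiz'⟩).symm)
  obtain ⟨k, hk⟩ := (hmem (c ⟨z, hz⟩) ⟨z, hz⟩).1 rfl
  obtain ⟨j, hj⟩ := hout (c ⟨z, hz⟩, k)
  exact hj (hk j)
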